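/- Let $\mathbb K$ be an algebraically closed field, $m\ge 0$, and let $X_m=(x_{ij})$ be the generic symmetric $m\times m$ matrix, whose entries $x_{ij}=x_{ji}$, $1\le i\le j\le m$, are the variables of the polynomial ring $R=\mathbb K[x_{ij}\mid 1\le i\le j\le m]$. For an ideal $I\subseteq R$ and $s\ge 1$, the symbolic power $I^{(s)}$ is the contraction to $R$ of the extension of $I^s$ to the localization of $R$ at the complement of the union of the minimal primes of $I$. The join of two ideals $I,J\subseteq R$ is $$I\ast J=\bigl(I(\mathbf y)+J(\mathbf z)+\langle x_{ij}-y_{ij}-z_{ij}\mid i\le j\rangle\bigr)\cap\mathbb K[\mathbf x],$$ where $\mathbf y,\mathbf z$ are two further copies of the variables $\mathbf x=(x_{ij})$ and $I(\mathbf y)$, $J(\mathbf z)$ are obtained from $I$, $J$ by substitution; for $r\ge 1$, $I^{\{r\}}=I\ast\cdots\ast I$ ($r$ factors) is the $r$-th secant ideal. The ideal $I$ is differentially perfect if for all $r\ge 1$ and $s\ge 1$ $$\bigl(I^{\{r\}}\bigr)^{(s)}=I^{\{r+s-1\}}+\sum_{i=1}^{s-1}\bigl(I^{\{r\}}\bigr)^{(i)}\bigl(I^{\{r\}}\bigr)^{(s-i)}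 .$$ A term order on $R$ is diagonal if the leading monomial of the minor of $X_m$ with rows $a_1<\dots<a_t$ and columns $b_1<\dots<b_t$ is $\prod_{i=1}^t x_{a_ib_i}$, for all such rows and columns. A Gröbner basis of an ideal is a finite subset of it whose leading terms generate the initial ideal. Let $\mathcal M_{k}(X_m)$ be the set of all $t\times t$ minors of $X_m$ with $t\ge k$. Theorem. The ideal $I_m\subseteq R$ generated by the $2\times 2$ minors of $X_m$ is differentially perfect. Moreover, for all $r\ge1$ and $s\ge 1$ the set $$\Bigl\{\prod_{i=1}^l f_i \;\Big|\; l\ge 0,\ f_i\in\mathcal M_{r+1}(X_m),\ \sum_{i=1}^l(\deg f_i-r)=s\Bigr\}$$ is a Gröbner basis of $\bigl(I_m^{\{r\}}\bigr)^{(s)}$ with respect to any diagonal term order. -/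

import Mathlib

namespace SymmetricMinors

open MvPolynomial

noncomputable section

section SymbolicPower

variable {R : Type*} [CommRing R]

/-- The multiplicative set of all elements of `R` lying in no minimal prime of `I`. -/
def minimalPrimesCompl (I : Ideal R) : Submonoid R where
  carrier := {u | ∀ p ∈ I.minimalPrimes, u ∉ p}
  one_mem' := fun p hp => (Ideal.ne_top_iff_one p).1 hp.1.1.ne_top
  mul_mem' := fun ha hb p hp hab => (hp.1.1.mem_or_mem hab).elim (ha p hp) (hb p hp)

/-- The symbolic power `I^{(s)}`: the contraction to `R` of the extension of `I ^ s` to the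
localization of `R` at the complement of the union of the minimal primes of `I`. -/
def symbolicPower (I : Ideal R) (s : ℕ) : Ideal R :=
  ((I ^ s).map (algebraMap R (Localization (minimalPrimesCompl I)))).comap
    (algebraMap R (Localization (minimalPrimesCompl I)))

end SymbolicPower

section Secant

variable {K : Type*} [Field K] {σ : Type*}

/-- The join `I ∗ J`: in the polynomial ring in three copies `x`, `y`, `z` of the variables, take
`I(y) + J(z) + ⟨x_i - y_i - z_i⟩` and intersect with `K[x]`. -/
def join (I J : Ideal (MvPolynomial σ K)) : Ideal (MvPolynomial σ K) :=
  let x : σ → σ ⊕ (σ ⊕ σ) := Sum.inl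
  let y : σ → σ ⊕ (σ ⊕ σ) := fun i => Sum.inr (Sum.inl i)
  let z : σ → σ ⊕ (σ ⊕ σ) := fun i => Sum.inr (Sum.inr i)
  (I.map (rename y : MvPolynomial σ K →ₐ[K] MvPolynomial (σ ⊕ (σ ⊕ σ)) K) +
    J.map (rename z : MvPolynomial σ K →ₐ[K] MvPolynomial (σ ⊕ (σ ⊕ σ)) K) +
    Ideal.span (Set.range fun i : σ =>
      (X (x i) - X (y i) - X (z i) : MvPolynomial (σ ⊕ (σ ⊕ σ)) K))).comap
    (rename x : MvPolynomial σ K →ₐ[K] MvPolynomial (σ ⊕ (σ ⊕ σ)) K)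

/-- The secant ideal `I^{r}`, the `r`-fold join `I ∗ ⋯ ∗ I` for `r ≥ 1`; for `r = 0` it is the
ideal of the variables, which is the neutral element of the join. -/
def secant (I : Ideal (MvPolynomial σ K)) : ℕ → Ideal (MvPolynomial σ K)
  | 0 => idealOfVars σ K
  | 1 => I
  | r + 2 => join (secant I (r + 1)) I

/-- `I` is `r`-differentially perfect (for `r ≥ 1`). -/
def IsDifferentiallyPerfectAt (I : Ideal (MvPolynomial σ K)) (r : ℕ) : Prop :=
  ∀ s : ℕ, 1 ≤ s →
    symbolicPower (secant I r) s =
      secant I (r + s - 1) +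
        ∑ i ∈ Finset.Icc 1 (s - 1),
          symbolicPower (secant I r) i * symbolicPower (secant I r) (s - i)

/-- `I` is differentially perfect: it is `r`-differentially perfect for all `r ≥ 1`. -/
def IsDifferentiallyPerfect (I : Ideal (MvPolynomial σ K)) : Prop :=
  ∀ r : ℕ, 1 ≤ r → IsDifferentiallyPerfectAt I r

/-- The finite set `G` is a Gröbner basis of `I`: it is contained in `I` and its leading terms
generate the initial ideal of `I`. -/
def IsGroebnerBasis (ord : MonomialOrder σ) (G : Set (MvPolynomial σ K))
    (I : Ideal (MvPolynomial σ K)) : Prop :=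
  G.Finite ∧ G ⊆ I ∧
    Ideal.span (ord.leadingTerm '' G) =
      Ideal.span (ord.leadingTerm '' (I : Set (MvPolynomial σ K)))

end Secant

section Minors

variable (K : Type*) [Field K] (m : ℕ)

/-- The generic symmetric `m × m` matrix; its variables `x_{ij} = x_{ji}` are indexed by unordered
pairs of indices. -/
def genericSymm : Matrix (Fin m) (Fin m) (MvPolynomial (Sym2 (Fin m)) K) :=
  Matrix.of fun i j => X s(i, j)

variable {m} in
/-- The minor of the generic symmetric matrix with rows `a` and columns `b`, both increasing. -/
def symmMinor {t : ℕ} (a b : Fin t ↪o Fin m) : MvPolynomial (Sym2 (Fin m)) K :=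
  ((genericSymm K m).submatrix a b).det

/-- The set of all `t × t` minors, for all `t ≥ k`. -/
def minorsGE (k : ℕ) : Set (MvPolynomial (Sym2 (Fin m)) K) :=
  {f | ∃ t : ℕ, k ≤ t ∧ ∃ a b : Fin t ↪o Fin m, f = symmMinor K a b}

/-- The ideal generated by the `2 × 2` minors. -/
def symmIdeal : Ideal (MvPolynomial (Sym2 (Fin m)) K) :=
  Ideal.span {f | ∃ a b : Fin 2 ↪o Fin m, f = symmMinor K a b}

/-- The products `f_1 ⋯ f_l` of minors of size at least `r + 1` with `∑ (deg f_i - r) = s`. -/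
def minorProducts (r s : ℕ) : Set (MvPolynomial (Sym2 (Fin m)) K) :=
  {g | ∃ (l : ℕ) (f : Fin l → MvPolynomial (Sym2 (Fin m)) K),
    (∀ i, f i ∈ minorsGE K m (r + 1)) ∧
    ∑ i, (((f i).totalDegree : ℤ) - (r : ℤ)) = (s : ℤ) ∧
    g = ∏ i, f i}

variable {m} in
/-- A term order is diagonal if the leading monomial of every minor is the product of the entries
on the main diagonal of the corresponding submatrix. -/
def IsDiagonal (ord : MonomialOrder (Sym2 (Fin m))) : Prop :=
  ∀ (t : ℕ) (a b : Fin t ↪o Fin m),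
    ord.degree (symmMinor K a b) = ∑ i, Finsupp.single s(a i, b i) 1

end Minors

end

end SymmetricMinors

/-! The core is a lower bound on leading monomials. Substitute `∑ v_k v_kᵀ + t z`, with `r` vectors
`v_k`, for the generic symmetric matrix (`deform`), and let `rankIdeal` be the prime ideal of the
polynomials that vanish at `t = 0`. Elements of its `s`-th symbolic power become divisible by `t ^
s` (`X_pow_dvd_deform`). Distribute the factors of the leading monomial of such an element over `r`
antichains of the diagonal order and a remainder. Antichains carry standard monomials, which a
diagonal term order makes least among the monomials with the same image under `x_ij ↦ v_i v_j`.
Hence the image of this distribution cannot cancel, and the remainder has at least `s` factors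
(`le_degree_filter_of_dvd_deform`).

By Greene–Kleitman duality (`exists_antichains_chains`) the leading monomial then contains disjoint
chains `C` with `∑ (|C| - r) ≥ s`. A chain is the diagonal of a minor, so some element of
`minorProducts` has a leading monomial dividing the given one (`exists_minorProducts_degree_le`).

Conversely, Sylvester's identity puts the minors of size `r + s` into the `s`-th symbolic power
(`symmMinor_mem_symbolicPower`), and `secant_symmIdeal` identifies secant ideals with rank ideals.
The products of minors are therefore Gröbner bases. Differential perfection follows by separating
the generators that are single minors from those with several factors. -/

namespace SymmetricMinors

/-! ### Assignment duality and the Greene–Kleitman theorem. -/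

section Duality

/-- Integral duality for the assignment problem with admissible pairs `A` and weights `w`. -/
theorem exists_tight_dual {ι : Type*} [Fintype ι] [DecidableEq ι] (A : ι → ι → Prop)
    (w : ι → ι → ℤ) (hA : ∀ i, A i i) :
    ∃ (u v : ι → ℤ) (σ : Equiv.Perm ι), (∀ i j, A i j → w i j ≤ u i + v j) ∧
      ∀ i, A i (σ i) ∧ u i + v (σ i) = w i (σ i) := by
  classical
  -- A least integral dual value exists: the identity assignment bounds all dual values below.
  obtain ⟨b, ⟨u, v, huv, rfl⟩, hmin⟩ := Int.exists_least_of_bdd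
    (P := fun z => ∃ u v : ι → ℤ, (∀ i j, A i j → w i j ≤ u i + v j) ∧ z = ∑ i, u i + ∑ i, v i)
    ⟨∑ i, w i i, by
      rintro z ⟨u, v, h, rfl⟩
      rw [← Finset.sum_add_distrib]
      exact Finset.sum_le_sum fun i _ => h i i (hA i)⟩
    ⟨_, fun i => ∑ j, |w i j|, 0, fun i j _ => by
      have := Finset.single_le_sum (f := fun j => |w i j|) (fun _ _ => abs_nonneg _)
        (Finset.mem_univ j)
      simpa using (le_abs_self _).trans this, rfl⟩
  let t : ι → Finset ι := fun i => {j | A i j ∧ u i + v j = w i j}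
  -- If Hall's condition failed on `s`, lowering `u` by one on `s` and raising `v` by one on its
  -- tight neighbours would stay feasible, since positive slacks are at least one, and would
  -- decrease the minimum.
  have hall : ∀ s : Finset ι, s.card ≤ (s.biUnion t).card := by
    intro s
    by_contra! hs
    have key := hmin _ ⟨fun i => u i - if i ∈ s then 1 else 0,
      fun j => v j + if j ∈ s.biUnion t then 1 else 0, fun i j hij => by
        have h := huv i j hij
        by_cases hi : i ∈ s
        · by_cases hj : j ∈ s.biUnion t
          · simp only [hi, hj, if_true]; omega
          · have : u i + v j ≠ w i j := fun h' =>
              hj (Finset.mem_biUnion.2 ⟨i, hi, by simp [t, hij, h']⟩)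
            simp only [hi, hj, if_true, if_false]; omega
        · simp only [hi, if_false]; split_ifs <;> omega, rfl⟩
    rw [Finset.sum_sub_distrib, Finset.sum_add_distrib] at key
    simp only [Finset.sum_ite_mem, Finset.univ_inter, Finset.sum_const, nsmul_eq_mul,
      mul_one] at key
    omega
  obtain ⟨f, hf, hft⟩ := (Finset.all_card_le_biUnion_card_iff_exists_injective t).1 hall
  refine ⟨u, v, Equiv.ofBijective f (Finite.injective_iff_bijective.1 hf), huv, fun i => ?_⟩
  simpa [t] using hft i

/-- A partial matching of a strict order by successors decomposes into chains: `σ` sends an element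
to its successor, or to itself if it is unused; a chain starts at the image of an `inr i`, and it is
labelled by that `i`. -/
theorem exists_chain_label {P κ : Type*} [Fintype P] [Nonempty κ] (lt : P → P → Prop)
    [IsStrictOrder P lt] (σ : Equiv.Perm (P ⊕ κ))
    (hσ : ∀ p q, σ (Sum.inl p) = Sum.inl q → p = q ∨ lt p q) :
    ∃ c : P → κ, (∀ p, σ (Sum.inl p) ≠ Sum.inl p → ∃ q, σ (Sum.inr (c p)) = Sum.inl q) ∧
      ∀ p q, σ (Sum.inl p) ≠ Sum.inl p → σ (Sum.inl q) ≠ Sum.inl q → c p = c q →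
        p = q ∨ lt p q ∨ lt q p := by
  classical
  have wf : WellFounded lt := Finite.wellFounded_of_trans_of_irrefl lt
  -- `d p` records the start of the chain through `p` and the position of `p` in it. The arbitrary
  -- label is reached only at fixed points of `σ`.
  obtain ⟨d, hd⟩ : ∃ d : P → κ × ℕ, ∀ p, d p =
      match σ.symm (Sum.inl p) with
      | Sum.inr i => (i, 0)
      | Sum.inl q => if lt q p then ((d q).1, (d q).2 + 1) else (Classical.arbitrary κ, 0) := by
    let F : ∀ p, (∀ q, lt q p → κ × ℕ) → κ × ℕ := fun p rec =>
      match σ.symm (Sum.inl p) with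
      | Sum.inr i => (i, 0)
      | Sum.inl q => if h : lt q p then ((rec q h).1, (rec q h).2 + 1)
          else (Classical.arbitrary κ, 0)
    refine ⟨wf.fix F, fun p => ?_⟩
    rw [wf.fix_eq]
    simp only [F]
    split <;> simp
  have step : ∀ p, σ (Sum.inl p) ≠ Sum.inl p →
      (∃ i, σ (Sum.inr i) = Sum.inl p ∧ d p = (i, 0)) ∨
      ∃ q, σ (Sum.inl q) = Sum.inl p ∧ lt q p ∧ σ (Sum.inl q) ≠ Sum.inl q ∧
        d p = ((d q).1, (d q).2 + 1) := by
    intro p hp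
    have h := hd p
    rcases hs : σ.symm (Sum.inl p) with q | i
    · rw [hs] at h
      rw [Equiv.symm_apply_eq] at hs
      have hqp : q ≠ p := fun e => hp (by rw [e] at hs; exact hs.symm)
      have hlt := (hσ q p hs.symm).resolve_left hqp
      refine Or.inr ⟨q, hs.symm, hlt, fun e => hqp ?_, by simpa [hlt] using h⟩
      rw [e] at hs
      exact (Sum.inl_injective hs).symm
    · rw [hs] at h
      rw [Equiv.symm_apply_eq] at hs
      exact Or.inl ⟨i, hs.symm, h⟩
  -- Induction on the position: equal labels and positions force equal predecessors, hence equal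
  -- elements.
  have key : ∀ n q, σ (Sum.inl q) ≠ Sum.inl q → (d q).2 = n → ∀ p, σ (Sum.inl p) ≠ Sum.inl p →
      (d p).1 = (d q).1 → (d p).2 ≤ n → p = q ∨ lt p q := by
    intro n
    induction n with
    | zero =>
      intro q hq hqn p hp hc hpn
      rcases step q hq with ⟨i, hi, hdi⟩ | ⟨q', -, -, -, hdq⟩
      · rcases step p hp with ⟨j, hj, hdj⟩ | ⟨p', -, -, -, hdp⟩
        · have : i = j := by simpa [hdi, hdj] using hc.symm
          rw [← this, hi] at hj
          exact Or.inl (Sum.inl_injective hj).symm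
        · simp [hdp] at hpn
      · simp [hdq] at hqn
    | succ n ih =>
      intro q hq hqn p hp hc hpn
      rcases step q hq with ⟨i, hi, hdi⟩ | ⟨q', hq', hlt, hu, hdq⟩
      · simp [hdi] at hqn
      have hn : (d q').2 = n := by simpa [hdq] using hqn
      have hc' : (d p).1 = (d q').1 := by simpa [hdq] using hc
      rcases Nat.lt_or_ge n (d p).2 with hlt' | hle
      · rcases step p hp with ⟨j, hj, hdj⟩ | ⟨p', hp', hltp, hup, hdp⟩
        · simp [hdj] at hlt'
        have hn' : (d p').2 = n := by
          simp only [hdp] at hlt' hpn; omega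
        have hcc : (d p').1 = (d q').1 := by simpa [hdp] using hc'
        have h1 := ih q' hu hn p' hup hcc hn'.le
        have h2 := ih p' hup hn' q' hu hcc.symm hn.le
        have : p' = q' := by
          rcases h1 with h1 | h1
          · exact h1
          · rcases h2 with h2 | h2
            · exact h2.symm
            · exact absurd (_root_.trans h1 h2) (irrefl p')
        rw [this, hq'] at hp'
        exact Or.inl (Sum.inl_injective hp').symm
      · rcases ih q' hu hn p hp hc' hle with h | h
        · exact Or.inr (h ▸ hlt)
        · exact Or.inr (_root_.trans h hlt)
  refine ⟨fun p => (d p).1, fun p => ?_, fun p q hp hq h => ?_⟩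
  · induction p using wf.induction with
    | _ p ih =>
      intro hp
      rcases step p hp with ⟨i, hi, hdi⟩ | ⟨q, -, hlt, hu, hdq⟩
      · exact ⟨p, by simpa [hdi] using hi⟩
      · simpa [hdq] using ih q hlt hu
  · rcases le_total (d p).2 (d q).2 with hle | hle
    · exact (key _ q hq rfl p hp h hle).imp_right Or.inl
    · exact (key _ p hp rfl q hq h.symm hle).imp Eq.symm Or.inr

/-- **Greene–Kleitman duality**: in a finite strict order there are `r` disjoint antichains (the
fibres of `τ` over `some k`) and a family of disjoint chains (the fibres of `c` over `D` in `U`)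
such that the antichains miss at most `∑ (|C| - r)` elements, the sum being over the chains `C`. -/
theorem exists_antichains_chains {P : Type*} [Fintype P] (lt : P → P → Prop) [IsStrictOrder P lt]
    (r : ℕ) :
    ∃ (τ : P → Option (Fin r)) (n : ℕ) (D : Finset (Fin n)) (c : P → Fin n) (U : Finset P),
      (∀ p q k, lt p q → τ p = some k → τ q ≠ some k) ∧
      (∀ p ∈ U, c p ∈ D) ∧
      (∀ p ∈ U, ∀ q ∈ U, c p = c q → p = q ∨ lt p q ∨ lt q p) ∧
      (Finset.univ.filter fun p => τ p = none).card + r * D.card ≤ U.card := by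
  classical
  -- One more chain slot than elements, so that some slot is matched to a slot; this normalizes the
  -- potentials in `ht`.
  let κ := Fin (Fintype.card P + 1)
  let A : P ⊕ κ → P ⊕ κ → Prop
    | Sum.inl p, Sum.inl q => p = q ∨ lt p q
    | _, _ => True
  -- Each used element earns `1` and each chain start costs `r`, so an assignment weighs `∑ (|C| -
  -- r)`.
  let w : P ⊕ κ → P ⊕ κ → ℤ
    | Sum.inl p, Sum.inl q => if p = q then 0 else 1
    | Sum.inl _, Sum.inr _ => 1
    | Sum.inr _, Sum.inl _ => -r
    | Sum.inr _, Sum.inr _ => 0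
  obtain ⟨u, v, σ, huv, hσ⟩ := exists_tight_dual A w (by rintro (p | i) <;> simp [A])
  obtain ⟨c, hc, hcc⟩ := exists_chain_label lt σ (fun p q h => by
    simpa [A, h] using (hσ (Sum.inl p)).1)
  obtain ⟨i₀, j₀, h₀⟩ : ∃ i j, σ (Sum.inr i) = Sum.inr j := by
    by_contra! hne
    have : ∀ i : κ, ∃ p, σ (Sum.inr i) = Sum.inl p := fun i => by
      rcases h : σ (Sum.inr i) with p | j
      · exact ⟨p, rfl⟩
      · exact absurd h (hne i j)
    choose f hf using this
    have hinj : Function.Injective f := fun i j h => by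
      have : σ (Sum.inr i) = σ (Sum.inr j) := by rw [hf, hf, h]
      exact Sum.inr_injective (σ.injective this)
    simpa [κ] using Fintype.card_le_of_injective f hinj
  have ht : u (Sum.inr i₀) + v (Sum.inr j₀) = 0 := by
    have := (hσ (Sum.inr i₀)).2
    rw [h₀] at this
    exact this
  have hy : ∀ p, 0 ≤ u (Sum.inl p) + v (Sum.inl p) := fun p => by
    simpa [A, w] using huv (Sum.inl p) (Sum.inl p)
  have hS : ∀ p, -(r : ℤ) ≤ u (Sum.inr i₀) + v (Sum.inl p) := fun p => huv _ _ trivial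
  have hT : ∀ p, 1 ≤ u (Sum.inl p) + v (Sum.inr j₀) := fun p => huv _ _ trivial
  -- Elements with tight loops are coloured by their potential. The bounds `hS` and `hT` leave
  -- exactly `r` colours, and a relation `p < q` within one colour would violate dual feasibility.
  let τ : P → Option (Fin r) := fun p =>
    if h : u (Sum.inl p) + v (Sum.inl p) = 0 then
      some ⟨(v (Sum.inl p) + r + u (Sum.inr i₀)).toNat, by have := hS p; have := hT p; omega⟩
    else none
  refine ⟨τ, _, Finset.univ.filter fun i => ∃ q, σ (Sum.inr i) = Sum.inl q, c,
    Finset.univ.filter fun p => σ (Sum.inl p) ≠ Sum.inl p, ?_, ?_, ?_, ?_⟩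
  · intro p q k hpq hp hq
    simp only [τ] at hp hq
    split_ifs at hp hq with h1 h2
    have h3 : 1 ≤ u (Sum.inl p) + v (Sum.inl q) := by
      have hne : p ≠ q := fun e => irrefl (r := lt) p (by rw [e] at hpq ⊢; exact hpq)
      simpa [A, w, hne, hpq] using huv (Sum.inl p) (Sum.inl q)
    have h4 := Fin.ext_iff.1 (Option.some_injective _ (hp.trans hq.symm))
    simp only at h4
    have := hS p
    have := hS q
    omega
  · intro p hp
    simpa using hc p (by simpa using hp)
  · intro p hp q hq
    exact hcc p q (by simpa using hp) (by simpa using hq)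
  · have hsum : ∑ i, w i (σ i) = ∑ i, (u i + v i) := by
      rw [Finset.sum_add_distrib, ← Equiv.sum_comp σ v, ← Finset.sum_add_distrib]
      exact Finset.sum_congr rfl fun i _ => (hσ i).2.symm
    rw [Fintype.sum_sum_type, Fintype.sum_sum_type] at hsum
    have h1 : ∑ p, w (Sum.inl p) (σ (Sum.inl p)) =
        ((Finset.univ.filter fun p => σ (Sum.inl p) ≠ Sum.inl p).card : ℤ) := by
      rw [Finset.card_filter]
      push_cast
      refine Finset.sum_congr rfl fun p _ => ?_
      rcases h : σ (Sum.inl p) with q | j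
      · simp only [w, ne_eq, Sum.inl.injEq, eq_comm (a := q)]
        split_ifs <;> rfl
      · simp [w]
    have h2 : ∑ i, w (Sum.inr i) (σ (Sum.inr i)) =
        -(r * ((Finset.univ.filter fun i => ∃ q, σ (Sum.inr i) = Sum.inl q).card : ℤ)) := by
      rw [Finset.card_filter]
      push_cast
      rw [Finset.mul_sum, ← Finset.sum_neg_distrib]
      refine Finset.sum_congr rfl fun i _ => ?_
      rcases h : σ (Sum.inr i) with q | j <;> simp [w]
    have h3 : 0 ≤ ∑ i : κ, (u (Sum.inr i) + v (Sum.inr i)) :=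
      Finset.sum_nonneg fun i _ => huv (Sum.inr i) (Sum.inr i) trivial
    have h4 : ((Finset.univ.filter fun p => τ p = none).card : ℤ) ≤
        ∑ p, (u (Sum.inl p) + v (Sum.inl p)) := by
      rw [Finset.card_filter]
      push_cast
      refine Finset.sum_le_sum fun p _ => ?_
      have := hy p
      simp only [τ]
      split_ifs with h5 h6
      · simp at h6
      · omega
      · omega
      · exact this
    zify
    linarith

end Duality

end SymmetricMinors

namespace SymmetricMinors

open MvPolynomial

universe u v

/-! ### Determinantal identities. -/

section Determinants

/-- Composing permutations with the swap of `i` and `j` keeps the product and flips the sign, so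
terms cancel in pairs over any commutative ring. -/
theorem det_eq_zero_of_rows {n S : Type*} [Fintype n] [DecidableEq n] [CommRing S]
    (M : Matrix n n S) {i j : n} (hij : i ≠ j) (h : ∀ k l, M i k * M j l = M i l * M j k) :
    M.det = 0 := by
  have hprod : ∀ σ : Equiv.Perm n, ∏ k, M k ((σ * Equiv.swap i j) k) = ∏ k, M k (σ k) := by
    intro σ
    have hj : j ∈ Finset.univ.erase i := by simp [hij.symm]
    rw [← Finset.mul_prod_erase _ _ (Finset.mem_univ i), ← Finset.mul_prod_erase _ _ hj,
      ← Finset.mul_prod_erase _ _ (Finset.mem_univ i), ← Finset.mul_prod_erase _ _ hj,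
      ← mul_assoc, ← mul_assoc]
    congr 1
    · simpa using h (σ j) (σ i)
    · refine Finset.prod_congr rfl fun k hk => ?_
      simp only [Finset.mem_erase, Finset.mem_univ, and_true] at hk
      simp [Equiv.swap_apply_of_ne_of_ne hk.2 hk.1]
  rw [← Matrix.det_transpose, Matrix.det_apply']
  simp only [Matrix.transpose_apply]
  refine Finset.sum_involution (fun σ _ => σ * Equiv.swap i j) (fun σ _ => ?_) (fun σ _ _ e => ?_)
    (fun _ _ => Finset.mem_univ _) (fun σ _ => by simp [mul_assoc])
  · rw [hprod]
    simp [Equiv.Perm.sign_swap hij]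
  · exact hij (Equiv.swap_eq_one_iff.1 (mul_eq_left.1 e))

/-- Expand multilinearly in the rows. Terms with two rows of `B` vanish by the rank-one condition;
any other term, expanded along its one exceptional row, has vanishing minors of `A` as cofactors. -/
theorem det_add_eq_zero {S : Type*} [CommRing S] {r : ℕ} (A B : Matrix (Fin (r + 1)) (Fin (r + 1)) S)
    (hA : ∀ a b : Fin r → Fin (r + 1), (A.submatrix a b).det = 0)
    (hB : ∀ i j k l, B i k * B j l = B i l * B j k) : (A + B).det = 0 := by
  classical
  have hone : ∀ (M : Matrix (Fin (r + 1)) (Fin (r + 1)) S) (i : Fin (r + 1)),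
      (∀ j, j ≠ i → M j = A j) → M.det = 0 := by
    intro M i hM
    rw [Matrix.det_succ_row M i]
    refine Finset.sum_eq_zero fun j _ => ?_
    have : M.submatrix i.succAbove j.succAbove = A.submatrix i.succAbove j.succAbove := by
      ext k l
      simp [hM _ (Fin.succAbove_ne i k)]
    rw [this, hA, mul_zero]
  have := (Matrix.detRowAlternating (n := Fin (r + 1)) (R := S)).map_add_univ A B
  refine this.trans (Finset.sum_eq_zero fun s _ => ?_)
  change Matrix.det (s.piecewise A B) = 0
  rcases Nat.lt_or_ge 1 sᶜ.card with hs | hs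
  · obtain ⟨i, hi, j, hj, hij⟩ := Finset.one_lt_card.1 hs
    rw [Finset.mem_compl] at hi hj
    refine det_eq_zero_of_rows _ hij fun k l => ?_
    have h1 : s.piecewise A B i = B i := Finset.piecewise_eq_of_notMem _ _ _ hi
    have h2 : s.piecewise A B j = B j := Finset.piecewise_eq_of_notMem _ _ _ hj
    simpa only [h1, h2] using hB i j k l
  · obtain ⟨i, hi⟩ : ∃ i, sᶜ ⊆ {i} := Finset.card_le_one_iff_subset_singleton.1 hs
    refine hone _ i fun j hj => Finset.piecewise_eq_of_mem _ _ _ ?_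
    by_contra hjs
    exact hj (by simpa using hi (Finset.mem_compl.2 hjs))

/-- **Sylvester's identity** for bordered minors, multiplied by the determinant of the block. -/
theorem det_pow_mul_det_fromBlocks {n R : Type*} {p : Type} [Fintype n] [DecidableEq n] [Fintype p]
    [DecidableEq p] [CommRing R] [IsDomain R] (A : Matrix n n R) (B : Matrix n p R)
    (C : Matrix p n R) (D : Matrix p p R) (hA : A.det ≠ 0) :
    A.det ^ Fintype.card p * (Matrix.fromBlocks A B C D).det =
      A.det * (Matrix.of fun i j => (Matrix.fromBlocks A (B.submatrix id fun _ : Unit => j)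
        (C.submatrix (fun _ : Unit => i) id)
        (D.submatrix (fun _ : Unit => i) fun _ : Unit => j)).det).det := by
  let φ := algebraMap R (FractionRing R)
  have hφ : Function.Injective φ := IsFractionRing.injective R (FractionRing R)
  apply hφ
  have hu : IsUnit (φ.mapMatrix A).det := by
    rw [← RingHom.map_det]
    exact isUnit_iff_ne_zero.2 ((map_ne_zero_iff φ hφ).2 hA)
  let := Matrix.invertibleOfIsUnitDet _ hu
  have hmap : ∀ {q : Type} [Fintype q] [DecidableEq q] (B' : Matrix n q R) (C' : Matrix q n R)
      (D' : Matrix q q R), φ (Matrix.fromBlocks A B' C' D').det =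
        φ A.det * (D'.map φ - C'.map φ * ⅟(φ.mapMatrix A) * B'.map φ).det := by
    intro q _ _ B' C' D'
    rw [RingHom.map_det, RingHom.map_det, RingHom.mapMatrix_apply, Matrix.fromBlocks_map]
    exact Matrix.det_fromBlocks₁₁ (φ.mapMatrix A) _ _ _
  rw [map_mul, map_mul, map_pow, hmap, RingHom.map_det φ (Matrix.of _)]
  -- Over the fraction field each bordered minor is `det A` times an entry of the Schur complement.
  have : φ.mapMatrix (Matrix.of fun i j => (Matrix.fromBlocks A (B.submatrix id fun _ : Unit => j)
        (C.submatrix (fun _ : Unit => i) id)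
        (D.submatrix (fun _ : Unit => i) fun _ : Unit => j)).det) =
      φ A.det • (D.map φ - C.map φ * ⅟(φ.mapMatrix A) * B.map φ) := by
    ext i j
    have h := hmap (B.submatrix id fun _ : Unit => j)
        (C.submatrix (fun _ : Unit => i) id)
        (D.submatrix (fun _ : Unit => i) fun _ : Unit => j)
    rw [RingHom.mapMatrix_apply, Matrix.map_apply, Matrix.of_apply, h, Matrix.det_unique (n := Unit)]
    rfl
  rw [this, Matrix.det_smul]
  ring

theorem det_mem_pow {n R : Type*} [Fintype n] [DecidableEq n] [CommRing R] (I : Ideal R)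
    (M : Matrix n n R) (h : ∀ i j, M i j ∈ I) : M.det ∈ I ^ Fintype.card n := by
  rw [Matrix.det_apply']
  refine Ideal.sum_mem _ fun σ _ => Ideal.mul_mem_left _ _ ?_
  have := Ideal.prod_mem_prod (s := Finset.univ) (I := fun _ : n => I)
    (x := fun i => M (σ i) i) fun i _ => h _ _
  simpa using this

end Determinants

/-! ### Symbolic powers of prime ideals. -/

section Symbolic

variable {R : Type*} [CommRing R]

theorem mem_symbolicPower {P : Ideal R} [hP : P.IsPrime] {s : ℕ} {f : R} :
    f ∈ symbolicPower P s ↔ ∃ u, u ∉ P ∧ u * f ∈ P ^ s := by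
  rw [symbolicPower, Ideal.mem_comap,
    IsLocalization.algebraMap_mem_map_algebraMap_iff (minimalPrimesCompl P)]
  have : ∀ u, u ∈ minimalPrimesCompl P ↔ u ∉ P := fun u => by
    change (∀ p ∈ P.minimalPrimes, u ∉ p) ↔ _
    simp [Ideal.minimalPrimes_eq_subsingleton_self]
  simp [this]

theorem mul_mem_symbolicPower {P : Ideal R} [hP : P.IsPrime] {s t : ℕ} {f g : R}
    (hf : f ∈ symbolicPower P s) (hg : g ∈ symbolicPower P t) :
    f * g ∈ symbolicPower P (s + t) := by
  rw [mem_symbolicPower] at *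
  obtain ⟨u, hu, huf⟩ := hf
  obtain ⟨v, hv, hvg⟩ := hg
  refine ⟨u * v, fun h => (hP.mem_or_mem h).elim hu hv, ?_⟩
  rw [mul_mul_mul_comm, pow_add]
  exact Ideal.mul_mem_mul huf hvg

theorem mem_symbolicPower_one {P : Ideal R} [hP : P.IsPrime] {f : R} :
    f ∈ symbolicPower P 1 ↔ f ∈ P := by
  rw [mem_symbolicPower]
  constructor
  · rintro ⟨u, hu, h⟩
    rw [pow_one] at h
    exact (hP.mem_or_mem h).resolve_left hu
  · exact fun h => ⟨1, (Ideal.ne_top_iff_one P).1 hP.ne_top, by simpa using h⟩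

end Symbolic

/-! ### Joins in terms of sums of points. -/

section Join

variable {K : Type*} [Field K] {σ : Type*}

theorem aeval_add_eq_zero_of_mem_join {A : Type*} [CommRing A] [Algebra K A]
    {I J : Ideal (MvPolynomial σ K)} {φ ψ : σ → A} (hφ : ∀ p ∈ I, aeval φ p = 0)
    (hψ : ∀ p ∈ J, aeval ψ p = 0) {f : MvPolynomial σ K} (hf : f ∈ join I J) :
    aeval (φ + ψ) f = 0 := by
  let χ : MvPolynomial (σ ⊕ (σ ⊕ σ)) K →ₐ[K] A := aeval (Sum.elim (φ + ψ) (Sum.elim φ ψ))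
  have hle : (I.map (rename (fun i => Sum.inr (Sum.inl i)) :
        MvPolynomial σ K →ₐ[K] MvPolynomial (σ ⊕ (σ ⊕ σ)) K) +
      J.map (rename (fun i => Sum.inr (Sum.inr i)) :
        MvPolynomial σ K →ₐ[K] MvPolynomial (σ ⊕ (σ ⊕ σ)) K) +
      Ideal.span (Set.range fun i : σ => (X (Sum.inl i) - X (Sum.inr (Sum.inl i)) -
        X (Sum.inr (Sum.inr i)) : MvPolynomial (σ ⊕ (σ ⊕ σ)) K))) ≤ RingHom.ker χ := by
    refine sup_le (sup_le ?_ ?_) ?_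
    · refine Ideal.map_le_iff_le_comap.2 fun p hp => ?_
      rw [Ideal.mem_comap, RingHom.mem_ker, aeval_rename]
      exact hφ p hp
    · refine Ideal.map_le_iff_le_comap.2 fun p hp => ?_
      rw [Ideal.mem_comap, RingHom.mem_ker, aeval_rename]
      exact hψ p hp
    · refine Ideal.span_le.2 ?_
      rintro _ ⟨i, rfl⟩
      simp [χ, RingHom.mem_ker]
  have := hle (Ideal.mem_comap.1 hf)
  rw [RingHom.mem_ker, aeval_rename] at this
  exact this

/-- The universal pair of points is given by the classes of `y` and `z` modulo the ideal defining
the join; its ring of definition fixes the universe of `A`. -/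
theorem mem_join {K : Type u} [Field K] {σ : Type v} {I J : Ideal (MvPolynomial σ K)}
    {f : MvPolynomial σ K}
    (h : ∀ {A : Type max u v} [CommRing A] [Algebra K A] (φ ψ : σ → A),
      (∀ p ∈ I, aeval φ p = 0) → (∀ p ∈ J, aeval ψ p = 0) → aeval (φ + ψ) f = 0) :
    f ∈ join I J := by
  rw [join, Ideal.mem_comap]
  dsimp only
  set Q := I.map (rename (fun i => Sum.inr (Sum.inl i)) :
        MvPolynomial σ K →ₐ[K] MvPolynomial (σ ⊕ (σ ⊕ σ)) K) +
      J.map (rename (fun i => Sum.inr (Sum.inr i)) :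
        MvPolynomial σ K →ₐ[K] MvPolynomial (σ ⊕ (σ ⊕ σ)) K) +
      Ideal.span (Set.range fun i : σ => (X (Sum.inl i) - X (Sum.inr (Sum.inl i)) -
        X (Sum.inr (Sum.inr i)) : MvPolynomial (σ ⊕ (σ ⊕ σ)) K)) with hQ
  let π : MvPolynomial (σ ⊕ (σ ⊕ σ)) K →ₐ[K] MvPolynomial (σ ⊕ (σ ⊕ σ)) K ⧸ Q :=
    Ideal.Quotient.mkₐ K Q
  have hπ : ∀ p, π p = 0 ↔ p ∈ Q := fun p => Ideal.Quotient.eq_zero_iff_mem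
  have hren : ∀ (g : σ → σ ⊕ (σ ⊕ σ)) (p : MvPolynomial σ K),
      aeval (fun i => π (X (g i))) p = π (rename g p) := fun g p => by
    rw [← AlgHom.comp_apply]
    congr 1
    ext i
    simp
  rw [← hπ, ← hren]
  have hx : (fun i => π (X (Sum.inl i))) = (fun i => π (X (Sum.inr (Sum.inl i)))) +
      fun i => π (X (Sum.inr (Sum.inr i))) := by
    ext i
    rw [Pi.add_apply, ← map_add, ← sub_eq_zero, ← map_sub, hπ, ← sub_sub]
    exact Ideal.mem_sup_right (Ideal.subset_span ⟨i, rfl⟩)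
  rw [hx]
  refine h _ _ (fun p hp => ?_) fun p hp => ?_
  · rw [hren, hπ]
    exact Ideal.mem_sup_left (Ideal.mem_sup_left (Ideal.mem_map_of_mem _ hp))
  · rw [hren, hπ]
    exact Ideal.mem_sup_left (Ideal.mem_sup_right (Ideal.mem_map_of_mem _ hp))

end Join

/-! ### Minors, secant ideals and symbolic powers. -/

section Secants

variable {K : Type*} [Field K] {m : ℕ}

theorem det_genericSymm_mem_symmIdeal (a b : Fin 2 → Fin m) :
    ((genericSymm K m).submatrix a b).det ∈ symmIdeal K m := by
  have hlt : ∀ a b : Fin 2 → Fin m, a 0 < a 1 → b 0 < b 1 →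
      ((genericSymm K m).submatrix a b).det ∈ symmIdeal K m := by
    intro a b ha hb
    refine Ideal.subset_span ⟨OrderEmbedding.ofStrictMono a ?_, OrderEmbedding.ofStrictMono b ?_,
      rfl⟩ <;> · rw [Fin.strictMono_iff_lt_succ]; intro i; fin_cases i; assumption
  have hrow : ∀ a b : Fin 2 → Fin m, b 0 < b 1 →
      ((genericSymm K m).submatrix a b).det ∈ symmIdeal K m := by
    intro a b hb
    rcases lt_trichotomy (a 0) (a 1) with h | h | h
    · exact hlt a b h hb
    · convert (symmIdeal K m).zero_mem
      simp [Matrix.det_fin_two, h, mul_comm]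
    · rw [← neg_mem_iff]
      convert hlt (fun i => a (Fin.rev i)) b h hb using 1
      simp [Matrix.det_fin_two, Fin.rev, mul_comm]
  rcases lt_trichotomy (b 0) (b 1) with h | h | h
  · exact hrow a b h
  · convert (symmIdeal K m).zero_mem
    simp [Matrix.det_fin_two, h]
  · rw [← neg_mem_iff]
    convert hrow a (fun i => b (Fin.rev i)) h using 1
    simp [Matrix.det_fin_two, Fin.rev]

/-- Adding a matrix whose `2`-minors vanish raises the size of the vanishing minors by one.
Arbitrary index maps are allowed so that the induction applies to all submatrices. -/
theorem det_genericSymm_mem_secant (r : ℕ) (a b : Fin (r + 2) → Fin m) :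
    ((genericSymm K m).submatrix a b).det ∈ secant (symmIdeal K m) (r + 1) := by
  induction r with
  | zero => exact det_genericSymm_mem_symmIdeal a b
  | succ r ih =>
    refine mem_join fun φ ψ hφ hψ => ?_
    rw [AlgHom.map_det]
    have hadd : (aeval (R := K) (φ + ψ)).mapMatrix ((genericSymm K m).submatrix a b) =
        (Matrix.of fun i j => φ s(a i, b j)) + Matrix.of fun i j => ψ s(a i, b j) := by
      ext i j
      simp [genericSymm]
    rw [hadd]
    refine det_add_eq_zero _ _ (fun a' b' => ?_) fun i j k l => ?_
    · rw [← hφ _ (ih (a ∘ a') (b ∘ b')), AlgHom.map_det]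
      congr 1
      ext i j
      simp [genericSymm]
    · have := hψ _ (det_genericSymm_mem_symmIdeal ![a i, a j] ![b k, b l])
      rw [← sub_eq_zero, ← this]
      simp only [Matrix.det_fin_two, Matrix.submatrix_apply]
      simp [genericSymm]

/-- The entries of the symmetric matrix `∑ v_k v_kᵀ`, indexed by unordered pairs. -/
def gram {A ι : Type*} [CommRing A] [Fintype ι] (v : ι → Fin m → A) (e : Sym2 (Fin m)) : A :=
  Sym2.lift ⟨fun i j => ∑ k, v k i * v k j, fun i j => by simp only [mul_comm]⟩ e

theorem gram_mk {A ι : Type*} [CommRing A] [Fintype ι] (v : ι → Fin m → A) (i j : Fin m) :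
    gram v s(i, j) = ∑ k, v k i * v k j := rfl

theorem aeval_gram_eq_zero {A : Type*} [CommRing A] [Algebra K A] (r : ℕ)
    (v : Fin (r + 1) → Fin m → A) {f : MvPolynomial (Sym2 (Fin m)) K}
    (hf : f ∈ secant (symmIdeal K m) (r + 1)) : aeval (gram v) f = 0 := by
  have hone : ∀ v : Fin 1 → Fin m → A,
      symmIdeal K m ≤ RingHom.ker (aeval (R := K) (gram v)) := by
    intro v
    refine Ideal.span_le.2 ?_
    rintro _ ⟨a, b, rfl⟩
    simp only [SetLike.mem_coe, RingHom.mem_ker, symmMinor, Matrix.det_fin_two, genericSymm,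
      Matrix.submatrix_apply, Matrix.of_apply, map_sub, map_mul, aeval_X, gram_mk,
      Finset.univ_unique, Finset.sum_singleton]
    ring
  induction r generalizing f with
  | zero => exact hone v hf
  | succ r ih =>
    have hg : gram v = gram (fun k => v (Fin.castSucc k)) +
        gram (fun _ : Fin 1 => v (Fin.last _)) := by
      ext e
      induction e with | _ i j => simp [gram_mk, Fin.sum_univ_castSucc]
    rw [hg]
    refine aeval_add_eq_zero_of_mem_join (fun p hp => ih _ hp) (fun p hp => ?_) hf
    exact hone _ hp

/-- Let `δ` be the leading `r`-minor. By Sylvester, `δ ^ s` times the minor is `δ` times an `s × s`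
determinant of bordered `(r + 1)`-minors, which lies in `P ^ s`, while `δ ^ s` is not in `P`. -/
theorem symmMinor_mem_symbolicPower {P : Ideal (MvPolynomial (Sym2 (Fin m)) K)} [hP : P.IsPrime]
    {r s : ℕ}
    (hmem : ∀ a b : Fin (r + 1) → Fin m, ((genericSymm K m).submatrix a b).det ∈ P)
    (hnot : ∀ a b : Fin r ↪o Fin m, symmMinor K a b ∉ P) (a b : Fin (r + s) ↪o Fin m) :
    symmMinor K a b ∈ symbolicPower P s := by
  let M := (genericSymm K m).submatrix (a ∘ finSumFinEquiv) (b ∘ finSumFinEquiv)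
  have hM : M.det = symmMinor K a b := by
    rw [symmMinor, ← Matrix.det_submatrix_equiv_self finSumFinEquiv]
    rfl
  have hδ : M.toBlocks₁₁.det =
      symmMinor K ((Fin.castAddOrderEmb s).trans a) ((Fin.castAddOrderEmb s).trans b) := rfl
  have hδP : M.toBlocks₁₁.det ∉ P := hδ ▸ hnot _ _
  refine mem_symbolicPower.2 ⟨_, fun h => hδP (hP.mem_of_pow_mem s h), ?_⟩
  have key := det_pow_mul_det_fromBlocks M.toBlocks₁₁ M.toBlocks₁₂ M.toBlocks₂₁ M.toBlocks₂₂
    (fun h => hδP (h ▸ P.zero_mem))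
  rw [Matrix.fromBlocks_toBlocks, hM, Fintype.card_fin] at key
  rw [key]
  refine Ideal.mul_mem_left _ _ ?_
  have := det_mem_pow P (Matrix.of fun i j => (Matrix.fromBlocks M.toBlocks₁₁
      (M.toBlocks₁₂.submatrix id fun _ : Unit => j) (M.toBlocks₂₁.submatrix (fun _ : Unit => i) id)
      (M.toBlocks₂₂.submatrix (fun _ : Unit => i) fun _ : Unit => j)).det) fun i j => ?_
  · rwa [Fintype.card_fin] at this
  let e : Fin (r + 1) ≃ Fin r ⊕ Unit := finSumFinEquiv.symm.trans
    (Equiv.sumCongr (Equiv.refl _) (Equiv.ofUnique _ _))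
  rw [Matrix.of_apply, ← Matrix.det_submatrix_equiv_self e]
  convert hmem (fun k => Sum.elim (fun x => a (Fin.castAdd s x)) (fun _ => a (Fin.natAdd r i)) (e k))
    (fun k => Sum.elim (fun x => b (Fin.castAdd s x)) (fun _ => b (Fin.natAdd r j)) (e k)) using 2
  ext k l
  rw [Matrix.submatrix_apply, Matrix.submatrix_apply]
  rcases e k with k | k <;> rcases e l with l | l <;> rfl

end Secants

end SymmetricMinors

namespace SymmetricMinors

open MvPolynomial

noncomputable section

/-! ### Standard monomials and straightening. -/

section StandardMonomials

variable {m : ℕ}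

/-- The strict order on unordered pairs whose chains are the diagonals of the minors. -/
def DiagLT (e f : Sym2 (Fin m)) : Prop := e.inf < f.inf ∧ e.sup < f.sup

instance : IsStrictOrder (Sym2 (Fin m)) DiagLT where
  irrefl _ h := lt_irrefl _ h.1
  trans _ _ _ h h' := ⟨h.1.trans h'.1, h.2.trans h'.2⟩

theorem mk_inf_sup (e : Sym2 (Fin m)) : s(e.inf, e.sup) = e :=
  Sym2.sortEquiv.symm_apply_apply e

/-- The two ends of an unordered pair, as an exponent vector. -/
def ends (e : Sym2 (Fin m)) : Fin m →₀ ℕ := Finsupp.single e.inf 1 + Finsupp.single e.sup 1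

theorem ends_mk (i j : Fin m) : ends s(i, j) = Finsupp.single i 1 + Finsupp.single j 1 := by
  rcases le_total i j with h | h
  · simp [ends, h]
  · simp [ends, h, add_comm]

/-- The exponent vector of the image of `x^c` under `x_{ij} ↦ v_i v_j`. -/
abbrev vertexDegree : (Sym2 (Fin m) →₀ ℕ) →+ (Fin m →₀ ℕ) := Finsupp.weight ends

/-- The monomial `x^c` is not divisible by the diagonal of a `2`-minor. -/
def IsStandard (c : Sym2 (Fin m) →₀ ℕ) : Prop := ∀ e ∈ c.support, ∀ f ∈ c.support, ¬ DiagLT e f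

theorem IsStandard.mono {c d : Sym2 (Fin m) →₀ ℕ} (hd : IsStandard d) (h : c ≤ d) :
    IsStandard c := fun e he f hf =>
  hd e (Finsupp.support_mono h he) f (Finsupp.support_mono h hf)

theorem vertexDegree_apply_ne_zero {c : Sym2 (Fin m) →₀ ℕ} {i : Fin m} :
    vertexDegree c i ≠ 0 ↔ ∃ e ∈ c.support, e.inf = i ∨ e.sup = i := by
  rw [Finsupp.weight_apply, Finsupp.sum, Finsupp.finsetSum_apply, ne_eq, Finset.sum_eq_zero_iff]
  push Not
  refine exists_congr fun e => and_congr_right fun he => ?_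
  rw [Finsupp.mem_support_iff] at he
  simp only [ends, Finsupp.smul_apply, Finsupp.add_apply, Finsupp.single_apply, smul_eq_mul, ne_eq,
    mul_eq_zero, he, false_or]
  split_ifs <;> simp_all

theorem vertexDegree_eq_zero_iff {c : Sym2 (Fin m) →₀ ℕ} : vertexDegree c = 0 ↔ c = 0 := by
  refine ⟨fun h => ?_, fun h => by rw [h, map_zero]⟩
  by_contra hc
  obtain ⟨e, he⟩ := Finsupp.support_nonempty_iff.2 hc
  exact vertexDegree_apply_ne_zero.2 ⟨e, he, Or.inl rfl⟩ (by rw [h]; rfl)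

/-- Take a pair starting at `p` and one ending at `q`. If neither were `s(p, q)`, they would be
diagonally comparable. -/
theorem IsStandard.outer_mem {c : Sym2 (Fin m) →₀ ℕ} (hc : IsStandard c) {p q : Fin m}
    (hp : vertexDegree c p ≠ 0) (hq : vertexDegree c q ≠ 0)
    (hpmin : ∀ i, vertexDegree c i ≠ 0 → p ≤ i) (hqmax : ∀ i, vertexDegree c i ≠ 0 → i ≤ q) :
    s(p, q) ∈ c.support := by
  have hbd : ∀ e ∈ c.support, p ≤ e.inf ∧ e.sup ≤ q := fun e he =>
    ⟨hpmin _ (vertexDegree_apply_ne_zero.2 ⟨e, he, Or.inl rfl⟩),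
      hqmax _ (vertexDegree_apply_ne_zero.2 ⟨e, he, Or.inr rfl⟩)⟩
  obtain ⟨e, he, hep⟩ : ∃ e ∈ c.support, e.inf = p := by
    obtain ⟨e, he, h | h⟩ := vertexDegree_apply_ne_zero.1 hp
    · exact ⟨e, he, h⟩
    · exact ⟨e, he, le_antisymm (h ▸ e.inf_le_sup) (hbd e he).1⟩
  obtain ⟨f, hf, hfq⟩ : ∃ f ∈ c.support, f.sup = q := by
    obtain ⟨f, hf, h | h⟩ := vertexDegree_apply_ne_zero.1 hq
    · exact ⟨f, hf, le_antisymm (hbd f hf).2 (h ▸ f.inf_le_sup)⟩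
    · exact ⟨f, hf, h⟩
  have hn := hc e he f hf
  rcases (hbd f hf).1.eq_or_lt with h | h
  · rw [h, ← hfq, mk_inf_sup]
    exact hf
  · rcases (hbd e he).2.eq_or_lt with h' | h'
    · rw [← h', ← hep, mk_inf_sup]
      exact he
    · exact absurd ⟨hep ▸ h, hfq ▸ h'⟩ hn

/-- A standard monomial is determined by its image under `x_{ij} ↦ v_i v_j`. -/
theorem IsStandard.eq_of_vertexDegree_eq {c d : Sym2 (Fin m) →₀ ℕ} (hc : IsStandard c)
    (hd : IsStandard d) (h : vertexDegree c = vertexDegree d) : c = d := by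
  obtain ⟨n, hn⟩ : ∃ n, c.degree = n := ⟨_, rfl⟩
  induction n generalizing c d with
  | zero =>
    rw [Finsupp.degree_eq_zero_iff] at hn
    rw [hn, map_zero] at h
    rw [hn, vertexDegree_eq_zero_iff.1 h.symm]
  | succ n ih =>
    have hne : (vertexDegree c).support.Nonempty := by
      rw [Finsupp.support_nonempty_iff, ne_eq, vertexDegree_eq_zero_iff]
      rintro rfl
      simp at hn
    let p := (vertexDegree c).support.min' hne
    let q := (vertexDegree c).support.max' hne
    have hp := Finsupp.mem_support_iff.1 ((vertexDegree c).support.min'_mem hne)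
    have hq := Finsupp.mem_support_iff.1 ((vertexDegree c).support.max'_mem hne)
    have hpm : ∀ i, vertexDegree c i ≠ 0 → p ≤ i := fun i hi =>
      Finset.min'_le _ _ (Finsupp.mem_support_iff.2 hi)
    have hqm : ∀ i, vertexDegree c i ≠ 0 → i ≤ q := fun i hi =>
      Finset.le_max' _ _ (Finsupp.mem_support_iff.2 hi)
    -- The variable joining the extreme vertices divides both monomials and can be cancelled.
    have h1 := hc.outer_mem hp hq hpm hqm
    have h2 := hd.outer_mem (h ▸ hp) (h ▸ hq) (fun i hi => hpm i (h ▸ hi))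
      (fun i hi => hqm i (h ▸ hi))
    have hle : ∀ {b : Sym2 (Fin m) →₀ ℕ}, s(p, q) ∈ b.support →
        b - Finsupp.single s(p, q) 1 + Finsupp.single s(p, q) 1 = b := fun hb =>
      tsub_add_cancel_of_le (Finsupp.single_le_iff.2
        (Nat.one_le_iff_ne_zero.2 (Finsupp.mem_support_iff.1 hb)))
    rw [← hle h1, ← hle h2]
    congr 1
    refine ih (hc.mono tsub_le_self) (hd.mono tsub_le_self) ?_ ?_
    · rw [← hle h1, ← hle h2, map_add, map_add] at h
      exact add_right_cancel h
    · rw [← hle h1, map_add, Finsupp.degree_single] at hn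
      omega

variable {K : Type*} [Field K]

/-- The two monomials are the terms of the `2`-minor with rows `e.inf, f.inf` and columns `e.sup,
f.sup`. -/
theorem IsDiagonal.swap_lt {ord : MonomialOrder (Sym2 (Fin m))} (hord : IsDiagonal K ord)
    {e f : Sym2 (Fin m)} (h : DiagLT e f) :
    ord.toSyn (Finsupp.single s(e.inf, f.sup) 1 + Finsupp.single s(f.inf, e.sup) 1) <
      ord.toSyn (Finsupp.single e 1 + Finsupp.single f 1) := by
  let a : Fin 2 ↪o Fin m := OrderEmbedding.ofStrictMono ![e.inf, f.inf] (by
    rw [Fin.strictMono_iff_lt_succ]; intro i; fin_cases i; exact h.1)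
  let b : Fin 2 ↪o Fin m := OrderEmbedding.ofStrictMono ![e.sup, f.sup] (by
    rw [Fin.strictMono_iff_lt_succ]; intro i; fin_cases i; exact h.2)
  have hdeg := hord 2 a b
  have hmin : symmMinor K a b = monomial (Finsupp.single e 1 + Finsupp.single f 1) 1 -
      monomial (Finsupp.single s(e.inf, f.sup) 1 + Finsupp.single s(f.inf, e.sup) 1) 1 := by
    simp only [symmMinor, Matrix.det_fin_two, Matrix.submatrix_apply, genericSymm, Matrix.of_apply]
    simp [a, b, mk_inf_sup, X, monomial_mul]
  have hne : Finsupp.single e 1 + Finsupp.single f 1 ≠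
      Finsupp.single s(e.inf, f.sup) 1 + Finsupp.single s(f.inf, e.sup) 1 := by
    intro heq
    have h1 : s(e.inf, f.sup) ≠ e := fun h' => by
      conv_rhs at h' => rw [← mk_inf_sup e]
      exact h.2.ne' (Sym2.congr_right.1 h')
    have h2 : s(f.inf, e.sup) ≠ e := fun h' => by
      conv_rhs at h' => rw [← mk_inf_sup e]
      exact h.1.ne' (Sym2.congr_left.1 h')
    have := DFunLike.congr_fun heq e
    simp [h1, h2] at this
  rw [Fin.sum_univ_two] at hdeg
  have hd' : ord.degree (symmMinor K a b) = Finsupp.single e 1 + Finsupp.single f 1 := by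
    rw [hdeg]
    simp [a, b, mk_inf_sup]
  rw [← hd']
  refine lt_of_le_of_ne (ord.le_degree ?_) fun heq => hne ?_
  · rw [mem_support_iff, hmin, coeff_sub, coeff_monomial, coeff_monomial, if_neg hne, if_pos rfl]
    simp
  · rw [← hd']
    exact (ord.toSyn.injective heq).symm

/-- Standard monomials are minimal among the monomials with the same image under
`x_{ij} ↦ v_i v_j`. -/
theorem IsStandard.le_of_vertexDegree_eq {ord : MonomialOrder (Sym2 (Fin m))}
    (hord : IsDiagonal K ord) {a c : Sym2 (Fin m) →₀ ℕ} (ha : IsStandard a)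
    (h : vertexDegree c = vertexDegree a) : ord.toSyn a ≤ ord.toSyn c := by
  obtain ⟨x, hx⟩ : ∃ x, ord.toSyn c = x := ⟨_, rfl⟩
  induction x using WellFoundedLT.induction generalizing c with
  | _ x ih =>
    by_cases hc : IsStandard c
    · rw [ha.eq_of_vertexDegree_eq hc h.symm]
    · simp only [IsStandard, not_forall, not_not] at hc
      obtain ⟨e, he, f, hf, hef⟩ := hc
      have hne : e ≠ f := fun h' => irrefl (r := DiagLT) e (by rw [h'] at hef ⊢; exact hef)
      obtain ⟨c₀, rfl⟩ : ∃ c₀, c = c₀ + (Finsupp.single e 1 + Finsupp.single f 1) := by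
        refine ⟨c - (Finsupp.single e 1 + Finsupp.single f 1), (tsub_add_cancel_of_le ?_).symm⟩
        intro g
        rw [Finsupp.mem_support_iff] at he hf
        simp only [Finsupp.add_apply, Finsupp.single_apply]
        split_ifs with h1 h2 h2
        · exact absurd (h1.trans h2.symm) hne
        · subst h1; omega
        · subst h2; omega
        · omega
      -- Straightening: the exchange keeps the vertex degrees and lowers the monomial, so the
      -- descent ends at the unique standard one.
      have hlt : ord.toSyn (c₀ + (Finsupp.single s(e.inf, f.sup) 1 +
          Finsupp.single s(f.inf, e.sup) 1)) <
          ord.toSyn (c₀ + (Finsupp.single e 1 + Finsupp.single f 1)) := by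
        rw [map_add, map_add ord.toSyn c₀]
        exact add_lt_add_right (hord.swap_lt hef) _
      refine (ih _ (hx ▸ hlt) ?_ rfl).trans hlt.le
      rw [← h]
      simp only [map_add, Finsupp.weight_single, one_smul, ends_mk]
      rw [ends, ends]
      abel

end StandardMonomials

end

end SymmetricMinors

namespace SymmetricMinors

open MvPolynomial

noncomputable section

/-! ### Leading monomials under the deformation. -/

section InitialTerms

variable {K : Type*} [Field K] {m r : ℕ}

/-- The variables `v_{k,i}`, `k < r`, of a sum of `r` symmetric matrices of rank one, and the
entries `z_e` of a general symmetric matrix. -/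
abbrev DeformVar (m r : ℕ) : Type := (Fin r × Fin m) ⊕ Sym2 (Fin m)

variable (K m r) in
/-- The substitution `x_{ij} ↦ ∑_k v_{k,i} v_{k,j} + t z_{ij}`. -/
def deform : MvPolynomial (Sym2 (Fin m)) K →ₐ[K] Polynomial (MvPolynomial (DeformVar m r) K) :=
  aeval fun e => Polynomial.C (gram (fun (k : Fin r) i => X (Sum.inl (k, i))) e) +
    Polynomial.X * Polynomial.C (X (Sum.inr e))

theorem coeff_zero_deform (f : MvPolynomial (Sym2 (Fin m)) K) :
    (deform K m r f).coeff 0 = aeval (gram fun (k : Fin r) i => (X (Sum.inl (k, i)) :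
      MvPolynomial (DeformVar m r) K)) f := by
  let φ : Polynomial (MvPolynomial (DeformVar m r) K) →ₐ[K] MvPolynomial (DeformVar m r) K :=
    (Polynomial.aeval (0 : MvPolynomial (DeformVar m r) K)).restrictScalars K
  have hφ : ∀ p, φ p = p.coeff 0 := fun p => by
    simp [φ, Polynomial.coeff_zero_eq_aeval_zero]
  rw [← hφ, ← AlgHom.comp_apply]
  congr 1
  ext e
  simp [deform, hφ]

/-- The substitution of the sum of `r + 1` copies of the variables. -/
def splitVars : MvPolynomial (Sym2 (Fin m)) K →ₐ[K]
    MvPolynomial (Option (Fin r) × Sym2 (Fin m)) K :=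
  aeval fun e => ∑ o, X (o, e)

/-- Killing all `y_{o,e}` with `o ≠ τ e` turns the substitution into a renaming. Thus no multinomial
coefficients appear, whatever the characteristic. -/
theorem coeff_splitVars (f : MvPolynomial (Sym2 (Fin m)) K) (τ : Sym2 (Fin m) → Option (Fin r))
    (c : Sym2 (Fin m) →₀ ℕ) :
    (splitVars f).coeff (c.mapDomain fun e => (τ e, e)) = f.coeff c := by
  have hinj : Function.Injective fun e => (τ e, e) := fun e e' h => (Prod.ext_iff.1 h).2
  rw [← coeff_killCompl hinj, ← AlgHom.comp_apply]
  have : (killCompl hinj).comp (splitVars (K := K) (m := m) (r := r)) = AlgHom.id K _ := by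
    ext1 e
    rw [AlgHom.comp_apply, splitVars, aeval_X, map_sum, Finset.sum_eq_single (τ e)]
    · have := killCompl_rename_app (R := K) hinj (X e)
      rwa [rename_X] at this
    · intro o _ ho
      have hr : (o, e) ∉ Set.range fun e => (τ e, e) := by
        rintro ⟨e', he'⟩
        obtain ⟨h1, rfl⟩ := Prod.mk.inj he'
        exact ho h1.symm
      rw [killCompl, aeval_X, dif_neg hr]
    · simp
  rw [this, AlgHom.id_apply]

/-- The sum of the copies of an exponent vector. -/
abbrev totalExp : (Option (Fin r) × Sym2 (Fin m) →₀ ℕ) →+ (Sym2 (Fin m) →₀ ℕ) :=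
  Finsupp.weight fun p => Finsupp.single p.2 1

/-- The substitution is homogeneous for the grading by total exponent vectors. -/
theorem totalExp_mem_support {f : MvPolynomial (Sym2 (Fin m)) K}
    {α : Option (Fin r) × Sym2 (Fin m) →₀ ℕ} (h : α ∈ (splitVars f).support) :
    totalExp α ∈ f.support := by
  have hX : ∀ (c : Sym2 (Fin m) →₀ ℕ) (x : K), IsWeightedHomogeneous
      (fun p : Option (Fin r) × Sym2 (Fin m) => Finsupp.single p.2 1)
      (splitVars (r := r) (monomial c x)) c := by
    intro c x
    rw [splitVars, aeval_monomial, Finsupp.prod]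
    have h1 := IsWeightedHomogeneous.prod c.support
      (fun e => (∑ o, X (o, e) : MvPolynomial (Option (Fin r) × Sym2 (Fin m)) K) ^ c e)
      (fun e => c e • Finsupp.single e 1)
      (w := fun p : Option (Fin r) × Sym2 (Fin m) => Finsupp.single p.2 1) fun e _ =>
        (IsWeightedHomogeneous.sum _ _ _ fun o _ => isWeightedHomogeneous_X K _ (o, e)).pow _
    have h2 : ∑ e ∈ c.support, c e • Finsupp.single e 1 = c := by
      simpa [Finsupp.sum] using Finsupp.sum_single c
    rw [h2] at h1
    exact h1.C_mul x
  rw [mem_support_iff, f.as_sum, map_sum, coeff_sum] at h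
  obtain ⟨c, hc, hne⟩ := Finset.exists_ne_zero_of_sum_ne_zero h
  rwa [show totalExp α = c from hX c _ hne]

/-- The copy with index `o` of an exponent vector. -/
abbrev expPart (o : Option (Fin r)) :
    (Option (Fin r) × Sym2 (Fin m) →₀ ℕ) →+ (Sym2 (Fin m) →₀ ℕ) :=
  Finsupp.weight fun p => if p.1 = o then Finsupp.single p.2 1 else 0

theorem expPart_apply (o : Option (Fin r)) (α : Option (Fin r) × Sym2 (Fin m) →₀ ℕ)
    (e : Sym2 (Fin m)) : expPart o α e = α (o, e) := by
  have : (Finsupp.applyAddHom e).comp (expPart o) = Finsupp.applyAddHom (o, e) := by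
    refine Finsupp.addHom_ext fun p n => ?_
    obtain ⟨o', e'⟩ := p
    simp only [AddMonoidHom.comp_apply, Finsupp.weight_single, Finsupp.applyAddHom_apply,
      Finsupp.smul_apply, Finsupp.single_apply, Prod.mk.injEq]
    by_cases h : o' = o <;> simp [h, Finsupp.single_apply]
  exact DFunLike.congr_fun this α

theorem totalExp_eq_sum (α : Option (Fin r) × Sym2 (Fin m) →₀ ℕ) :
    totalExp α = ∑ o, expPart o α := by
  have : (totalExp : (Option (Fin r) × Sym2 (Fin m) →₀ ℕ) →+ _) = ∑ o, expPart o := by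
    refine Finsupp.addHom_ext fun p n => ?_
    simp [Finsupp.weight_single, -Fintype.sum_option]
  rw [this, AddMonoidHom.finsetSum_apply]

/-- The exponent vector of the image of a variable `y_{o,e}` under `y_{k,ij} ↦ v_{k,i} v_{k,j}`,
`y_{none,e} ↦ t z_e`, leaving out `t`. -/
def imageVarExp : Option (Fin r) × Sym2 (Fin m) → (DeformVar m r →₀ ℕ)
  | (none, e) => Finsupp.single (Sum.inr e) 1
  | (some k, e) => Finsupp.single (Sum.inl (k, e.inf)) 1 + Finsupp.single (Sum.inl (k, e.sup)) 1

/-- The exponent of `t` in the image of `y_{o,e}`. -/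
def imageVarOrder (p : Option (Fin r) × Sym2 (Fin m)) : ℕ := if p.1 = none then 1 else 0

theorem imageExp_inr (α : Option (Fin r) × Sym2 (Fin m) →₀ ℕ) (e : Sym2 (Fin m)) :
    Finsupp.weight imageVarExp α (Sum.inr e) = expPart none α e := by
  have : (Finsupp.applyAddHom (Sum.inr e)).comp
      (Finsupp.weight (imageVarExp (m := m) (r := r))) =
      (Finsupp.applyAddHom e).comp (expPart none) := by
    refine Finsupp.addHom_ext fun p n => ?_
    obtain ⟨_ | k, e'⟩ := p <;>
      simp [Finsupp.weight_single, imageVarExp, Finsupp.single_apply]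
  exact DFunLike.congr_fun this α

theorem imageExp_inl (α : Option (Fin r) × Sym2 (Fin m) →₀ ℕ) (k : Fin r) (i : Fin m) :
    Finsupp.weight imageVarExp α (Sum.inl (k, i)) = vertexDegree (expPart (some k) α) i := by
  have : (Finsupp.applyAddHom (Sum.inl (k, i))).comp
      (Finsupp.weight (imageVarExp (m := m) (r := r))) =
      (Finsupp.applyAddHom i).comp (vertexDegree.comp (expPart (some k))) := by
    refine Finsupp.addHom_ext fun p n => ?_
    obtain ⟨_ | k', e'⟩ := p
    · simp [Finsupp.weight_single, imageVarExp]
    · by_cases hk : k' = k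
      · simp [Finsupp.weight_single, imageVarExp, Finsupp.single_apply, ends, hk]
      · simp [Finsupp.weight_single, imageVarExp, hk]
  exact DFunLike.congr_fun this α

theorem imageOrder_eq (α : Option (Fin r) × Sym2 (Fin m) →₀ ℕ) :
    Finsupp.weight imageVarOrder α = (expPart none α).degree := by
  have : Finsupp.weight (imageVarOrder (m := m) (r := r)) =
      Finsupp.degree.comp (expPart none) := by
    refine Finsupp.addHom_ext fun p n => ?_
    obtain ⟨_ | k, e⟩ := p <;> simp [Finsupp.weight_single, imageVarOrder]
  exact DFunLike.congr_fun this α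

/-- The substitution `y_{k,ij} ↦ v_{k,i} v_{k,j}`, `y_{none,e} ↦ t z_e`. -/
def monomialSubst : MvPolynomial (Option (Fin r) × Sym2 (Fin m)) K →ₐ[K]
    Polynomial (MvPolynomial (DeformVar m r) K) :=
  aeval fun p => Polynomial.monomial (imageVarOrder p) (monomial (imageVarExp p) 1)

theorem monomialSubst_splitVars (f : MvPolynomial (Sym2 (Fin m)) K) :
    monomialSubst (r := r) (splitVars f) = deform K m r f := by
  rw [← AlgHom.comp_apply]
  congr 1
  ext1 e
  rw [AlgHom.comp_apply, splitVars, aeval_X, map_sum, Fintype.sum_option, deform, aeval_X,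
    add_comm]
  simp only [monomialSubst, aeval_X, imageVarOrder, imageVarExp]
  congr 1
  · conv_rhs => rw [← mk_inf_sup e, gram_mk, map_sum]
    refine Finset.sum_congr rfl fun k _ => ?_
    simp [X, monomial_mul]
  · simp [X, Polynomial.X_mul_C, Polynomial.C_mul_X_eq_monomial]

theorem monomialSubst_monomial (α : Option (Fin r) × Sym2 (Fin m) →₀ ℕ) (x : K) :
    monomialSubst (monomial α x) = Polynomial.monomial (Finsupp.weight imageVarOrder α)
      (monomial (Finsupp.weight imageVarExp α) x) := by
  have hone : ∀ α : Option (Fin r) × Sym2 (Fin m) →₀ ℕ, monomialSubst (monomial α (1 : K)) =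
      Polynomial.monomial (Finsupp.weight imageVarOrder α)
        (monomial (Finsupp.weight imageVarExp α) (1 : K)) := by
    intro α
    induction α using Finsupp.induction_linear with
    | zero => simp
    | add a b ha hb =>
      rw [← one_mul (1 : K), ← monomial_mul, map_mul, ha, hb, Polynomial.monomial_mul_monomial,
        monomial_mul, map_add, map_add]
    | single p n =>
      rw [← X_pow_eq_monomial, map_pow, monomialSubst, aeval_X, Polynomial.monomial_pow,
        monomial_pow, Finsupp.weight_single, Finsupp.weight_single, one_pow, smul_eq_mul, mul_comm]
  have : (monomial α x : MvPolynomial (Option (Fin r) × Sym2 (Fin m)) K) = x • monomial α 1 := by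
    rw [smul_monomial, smul_eq_mul, mul_one]
  rw [this, map_smul, hone, Polynomial.smul_monomial, smul_monomial, smul_eq_mul, mul_one]

/-- If `t ^ s` divides `f(∑ v_k v_kᵀ + t z)` then every union of `r` antichains in the support of
the leading monomial of `f` misses at least `s` of its factors. -/
theorem le_degree_filter_of_dvd_deform {ord : MonomialOrder (Sym2 (Fin m))}
    (hord : IsDiagonal K ord) {f : MvPolynomial (Sym2 (Fin m)) K} (hf : f ≠ 0) {s : ℕ}
    (hs : Polynomial.X ^ s ∣ deform K m r f) (τ : Sym2 (Fin m) → Option (Fin r))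
    (hτ : ∀ e ∈ (ord.degree f).support, ∀ e' ∈ (ord.degree f).support, ∀ k, DiagLT e e' →
      τ e = some k → τ e' ≠ some k) :
    s ≤ ((ord.degree f).filter fun e => τ e = none).degree := by
  classical
  by_contra! hlt
  set M := ord.degree f with hM
  set α₀ : Option (Fin r) × Sym2 (Fin m) →₀ ℕ := M.mapDomain fun e => (τ e, e) with hα₀
  have hinj : Function.Injective fun e => (τ e, e) := fun e e' h => (Prod.ext_iff.1 h).2
  have hpart : ∀ o, expPart o α₀ = M.filter fun e => τ e = o := by
    intro o
    ext e
    rw [expPart_apply, Finsupp.filter_apply]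
    split_ifs with h
    · rw [← h]
      exact Finsupp.mapDomain_apply hinj M e
    · refine Finsupp.mapDomain_of_notMem_range _ _ ?_
      rintro ⟨e', he'⟩
      obtain ⟨h1, rfl⟩ := Prod.mk.inj he'
      exact h h1
  have htot : totalExp α₀ = M := by
    rw [totalExp_eq_sum]
    ext e
    simp [hpart, Finsupp.finsetSum_apply, Finsupp.filter_apply, -Fintype.sum_option]
  have hstd : ∀ k, IsStandard (expPart (some k) α₀) := by
    intro k e he e' he' hlt
    rw [hpart, Finsupp.support_filter, Finset.mem_filter] at he he'
    exact hτ e he.1 e' he'.1 k hlt he.2 he'.2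
  -- Each part of `α₀` is least among those with its image, and the parts of `α` sum to at most the
  -- leading exponent `M`; hence all parts agree.
  have huniq : ∀ α ∈ (splitVars f).support,
      Finsupp.weight imageVarExp α = Finsupp.weight imageVarExp α₀ → α = α₀ := by
    intro α hα h
    have hle : ∀ o, ord.toSyn (expPart o α₀) ≤ ord.toSyn (expPart o α) := by
      rintro (_ | k)
      · refine le_of_eq (congr_arg _ ?_)
        ext e
        rw [← imageExp_inr, ← imageExp_inr, h]
      · refine (hstd k).le_of_vertexDegree_eq hord ?_
        ext i
        rw [← imageExp_inl, ← imageExp_inl, h]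
    have hge : ord.toSyn (totalExp α) ≤ ord.toSyn (totalExp α₀) := by
      rw [htot]
      exact ord.le_degree (totalExp_mem_support hα)
    rw [totalExp_eq_sum, totalExp_eq_sum, map_sum, map_sum] at hge
    have heq := (Finset.sum_eq_sum_iff_of_le fun o _ => hle o).1
      (le_antisymm (Finset.sum_le_sum fun o _ => hle o) hge)
    ext ⟨o, e⟩
    rw [← expPart_apply, ← expPart_apply, ord.toSyn.injective (heq o (Finset.mem_univ _))]
  have hcoeff : ((deform K m r f).coeff (Finsupp.weight imageVarOrder α₀)).coeff
      (Finsupp.weight imageVarExp α₀) = f.coeff M := by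
    rw [← monomialSubst_splitVars, ← coeff_splitVars f τ M, ← hα₀]
    conv_lhs => rw [(splitVars f).as_sum, map_sum]
    simp only [monomialSubst_monomial, Polynomial.finsetSum_coeff, coeff_sum,
      Polynomial.coeff_monomial]
    rw [Finset.sum_eq_single α₀]
    · simp
    · intro α hα hne
      split_ifs
      · rw [coeff_monomial, if_neg fun h => hne (huniq α hα h)]
      · simp
    · intro h
      simp [notMem_support_iff.1 h]
  rw [Polynomial.X_pow_dvd_iff.1 hs _ (by rwa [imageOrder_eq, hpart]), coeff_zero] at hcoeff
  exact hf (ord.coeff_degree_eq_zero_iff.1 hcoeff.symm)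

end InitialTerms

end

end SymmetricMinors

namespace SymmetricMinors

open MvPolynomial

noncomputable section

/-! ### Existence of a diagonal term order. -/

section LexOrder

variable {m : ℕ}

/-- A variable can occupy two mirrored positions, but neither is weakly south-east of the other. -/
theorem mk_eq_mk_of_le {i j k l : Fin m} (hik : i ≤ k) (hjl : j ≤ l) (h : s(k, l) = s(i, j)) :
    k = i ∧ l = j := by
  rcases Sym2.eq_iff.1 h with h | ⟨rfl, rfl⟩
  · exact h
  · exact ⟨le_antisymm hjl hik, le_antisymm hik hjl⟩

theorem symmMinor_eq_sum (K : Type*) [Field K] {t : ℕ} (a b : Fin t ↪o Fin m) :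
    symmMinor K a b = ∑ σ : Equiv.Perm (Fin t),
      monomial (∑ i, Finsupp.single s(a (σ i), b i) 1) ((Equiv.Perm.sign σ : ℤ) : K) := by
  rw [symmMinor, Matrix.det_apply']
  refine Finset.sum_congr rfl fun σ _ => ?_
  have : ∏ i, (X s(a (σ i), b i) : MvPolynomial (Sym2 (Fin m)) K) =
      monomial (∑ i, Finsupp.single s(a (σ i), b i) 1) 1 := by
    simp [monomial_sum_one, X]
  simp only [genericSymm, Matrix.submatrix_apply, Matrix.of_apply]
  rw [this, ← map_intCast (C : K →+* MvPolynomial (Sym2 (Fin m)) K), C_mul_monomial, mul_one]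

/-- The variables, sorted lexicographically by their row and column in the upper triangle. -/
abbrev SortedPair (m : ℕ) : Type := {p : Fin m ×ₗ Fin m // (ofLex p).1 ≤ (ofLex p).2}

/-- The index of a variable in the upper triangle. -/
def sortedPairEquiv : Sym2 (Fin m) ≃ SortedPair m :=
  Sym2.sortEquiv.trans (Equiv.subtypeEquiv toLex fun _ => Iff.rfl)

theorem sortedPairEquiv_mono {i j k l : Fin m} (hik : i ≤ k) (hjl : j ≤ l) :
    sortedPairEquiv s(i, j) ≤ sortedPairEquiv s(k, l) :=
  Subtype.coe_le_coe.1
    (Prod.Lex.toLex_mono (Prod.mk_le_mk.2 ⟨inf_le_inf hik hjl, sup_le_sup hik hjl⟩))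

/-- The lexicographic term order with `x_{11} > x_{12} > ⋯ > x_{1m} > x_{22} > ⋯ > x_{mm}`. -/
def upperLex (m : ℕ) : MonomialOrder (Sym2 (Fin m)) where
  syn := (MonomialOrder.lex (σ := SortedPair m)).syn
  toSyn := (Finsupp.domCongr sortedPairEquiv).trans MonomialOrder.lex.toSyn
  toSyn_monotone c d h := (MonomialOrder.lex (σ := SortedPair m)).toSyn_monotone
    (a := Finsupp.domCongr sortedPairEquiv c) (b := Finsupp.domCongr sortedPairEquiv d)
    fun p => h (sortedPairEquiv.symm p)

theorem upperLex_lt {c d : Sym2 (Fin m) →₀ ℕ} (e : Sym2 (Fin m))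
    (hlt : ∀ f, sortedPairEquiv f < sortedPairEquiv e → c f = d f) (he : c e < d e) :
    (upperLex m).toSyn c < (upperLex m).toSyn d := by
  change MonomialOrder.lex.toSyn (Finsupp.domCongr sortedPairEquiv c) <
    MonomialOrder.lex.toSyn (Finsupp.domCongr sortedPairEquiv d)
  rw [MonomialOrder.lex_lt_iff, Finsupp.Lex.lt_iff]
  refine ⟨sortedPairEquiv e, fun p hp => ?_, ?_⟩
  · exact hlt (sortedPairEquiv.symm p) (by simpa using hp)
  · change c (sortedPairEquiv.symm (sortedPairEquiv e)) < d (sortedPairEquiv.symm _)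
    simpa using he

/-- At the first index moved by `σ`, the diagonal entry is the largest variable of the remaining
block, and the remaining factors of the `σ`-term avoid it. One such order is needed for ideal
equalities that mention none. -/
theorem isDiagonal_upperLex (K : Type*) [Field K] (m : ℕ) : IsDiagonal K (upperLex m) := by
  intro t a b
  have hlt : ∀ σ : Equiv.Perm (Fin t), σ ≠ 1 →
      (upperLex m).toSyn (∑ i, Finsupp.single s(a (σ i), b i) 1) <
        (upperLex m).toSyn (∑ i, Finsupp.single s(a i, b i) 1) := by
    intro σ hσ
    obtain ⟨i₀, hi₀, hmin⟩ := wellFounded_lt.has_min {i | σ i ≠ i} (by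
      by_contra! h
      exact hσ (Equiv.ext fun i => not_not.1 (Set.eq_empty_iff_forall_notMem.1 h i)))
    have hfix : ∀ i, i < i₀ → σ i = i := fun i hi => not_not.1 fun h => hmin i h hi
    have hge : ∀ i, i₀ ≤ i → i₀ ≤ σ i := fun i hi => by
      by_contra! h
      exact absurd (σ.injective (hfix _ h)) (h.trans_le hi).ne
    have hne : ∀ i, i₀ ≤ i → s(a (σ i), b i) ≠ s(a i₀, b i₀) := fun i hi h => by
      obtain ⟨h1, h2⟩ := mk_eq_mk_of_le (a.monotone (hge i hi)) (b.monotone hi) h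
      obtain rfl := b.injective h2
      exact hi₀ (a.injective h1)
    refine upperLex_lt s(a i₀, b i₀) (fun e he => ?_) ?_
    · have hne' : ∀ k l, i₀ ≤ k → i₀ ≤ l → e ≠ s(a k, b l) := fun k l hk hl h' =>
        (he.trans_le (sortedPairEquiv_mono (a.monotone hk) (b.monotone hl))).ne (by rw [h'])
      simp only [Finsupp.finsetSum_apply]
      refine Finset.sum_congr rfl fun i _ => ?_
      rcases lt_or_ge i i₀ with hi | hi
      · rw [hfix i hi]
      · rw [Finsupp.single_eq_of_ne, Finsupp.single_eq_of_ne]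
        · exact hne' _ _ hi hi
        · exact hne' _ _ (hge i hi) hi
    · simp only [Finsupp.finsetSum_apply]
      refine Finset.sum_lt_sum (fun i _ => ?_) ⟨i₀, Finset.mem_univ _, ?_⟩
      · rcases lt_or_ge i i₀ with hi | hi
        · rw [hfix i hi]
        · rw [Finsupp.single_eq_of_ne (hne i hi).symm]
          exact Nat.zero_le _
      · rw [Finsupp.single_eq_of_ne (hne i₀ le_rfl).symm, Finsupp.single_eq_same]
        exact one_pos
  have hcoeff : (symmMinor K a b).coeff (∑ i, Finsupp.single s(a i, b i) 1) = 1 := by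
    rw [symmMinor_eq_sum, coeff_sum, Finset.sum_eq_single 1]
    · simp
    · intro σ _ hσ
      rw [coeff_monomial, if_neg fun h => (hlt σ hσ).ne (congr_arg _ h)]
    · simp
  refine (upperLex m).toSyn.injective (le_antisymm ?_ ((upperLex m).le_degree ?_))
  · rw [symmMinor_eq_sum]
    refine (upperLex m).degree_sum_le.trans (Finset.sup_le fun σ _ => ?_)
    refine ((upperLex m).degree_monomial_le _).trans ?_
    by_cases hσ : σ = 1
    · simp [hσ]
    · exact (hlt σ hσ).le
  · rw [mem_support_iff, hcoeff]
    exact one_ne_zero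

end LexOrder

/-! ### Products of minors and chains of variables. -/

section MinorProducts

variable {K : Type*} [Field K] {m : ℕ}

theorem symmMinor_ne_zero {t : ℕ} (a b : Fin t ↪o Fin m) : symmMinor K a b ≠ 0 := by
  cases t with
  | zero => simp [symmMinor]
  | succ t =>
    refine (upperLex m).ne_zero_of_degree_ne_zero ?_
    rw [isDiagonal_upperLex K m, Fin.sum_univ_succ]
    intro h
    have := DFunLike.congr_fun h s(a 0, b 0)
    simp at this

theorem totalDegree_symmMinor {t : ℕ} (a b : Fin t ↪o Fin m) :
    (symmMinor K a b).totalDegree = t := by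
  refine IsHomogeneous.totalDegree ?_ (symmMinor_ne_zero a b)
  rw [symmMinor_eq_sum]
  refine IsHomogeneous.sum _ _ _ fun σ _ => isHomogeneous_monomial _ ?_
  simp [map_sum]

theorem minorProducts_ne_zero {r s : ℕ} {g : MvPolynomial (Sym2 (Fin m)) K}
    (hg : g ∈ minorProducts K m r s) : g ≠ 0 := by
  obtain ⟨l, f, hf, -, rfl⟩ := hg
  refine Finset.prod_ne_zero_iff.2 fun i _ => ?_
  obtain ⟨t, -, a, b, h⟩ := hf i
  rw [h]
  exact symmMinor_ne_zero a b

theorem one_mem_minorProducts (r : ℕ) :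
    (1 : MvPolynomial (Sym2 (Fin m)) K) ∈ minorProducts K m r 0 :=
  ⟨0, Fin.elim0, fun i => i.elim0, by simp, by simp⟩

theorem mul_mem_minorProducts {r s s' : ℕ} {g g' : MvPolynomial (Sym2 (Fin m)) K}
    (hg : g ∈ minorProducts K m r s) (hg' : g' ∈ minorProducts K m r s') :
    g * g' ∈ minorProducts K m r (s + s') := by
  obtain ⟨l, f, hf, hs, rfl⟩ := hg
  obtain ⟨l', f', hf', hs', rfl⟩ := hg'
  refine ⟨l + l', Fin.append f f', fun i => ?_, ?_, ?_⟩
  · refine Fin.addCases (fun i => ?_) (fun i => ?_) i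
    · simpa using hf i
    · simpa using hf' i
  · rw [Fin.sum_univ_add]
    simp [hs, hs']
  · rw [Fin.prod_univ_add]
    simp

theorem symmMinor_mem_minorProducts {r s : ℕ} (hs : 1 ≤ s) (a b : Fin (r + s) ↪o Fin m) :
    symmMinor K a b ∈ minorProducts K m r s :=
  ⟨1, fun _ => symmMinor K a b, fun _ => ⟨r + s, by omega, a, b, rfl⟩,
    by simp [totalDegree_symmMinor], by simp⟩

theorem prod_mem_minorProducts {ι : Type*} {r : ℕ} (S : Finset ι) (y : ι → ℕ)
    (g : ι → MvPolynomial (Sym2 (Fin m)) K) (h : ∀ i, g i ∈ minorProducts K m r (y i)) :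
    ∏ i ∈ S, g i ∈ minorProducts K m r (∑ i ∈ S, y i) := by
  classical
  induction S using Finset.induction_on with
  | empty => simpa using one_mem_minorProducts r
  | insert i S hi ih =>
    rw [Finset.prod_insert hi, Finset.sum_insert hi]
    exact mul_mem_minorProducts (h i) ih

/-- Each factor contributes at least one to the sum, so there are at most `s` factors. -/
theorem finite_minorProducts (r s : ℕ) : (minorProducts K m r s).Finite := by
  have hfin : (minorsGE K m (r + 1)).Finite := by
    refine Set.Finite.subset (s := ⋃ t ∈ Set.Iic m, Set.range
      fun ab : (Fin t ↪o Fin m) × (Fin t ↪o Fin m) => symmMinor K ab.1 ab.2)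
      ((Set.finite_Iic m).biUnion fun t _ => Set.finite_range _) ?_
    rintro _ ⟨t, -, a, b, rfl⟩
    have : t ≤ m := by simpa using Fintype.card_le_of_injective a a.injective
    exact Set.mem_biUnion this ⟨(a, b), rfl⟩
  refine Set.Finite.subset (s := ⋃ l ∈ Set.Iic s, (fun f : Fin l → _ => ∏ i, f i) ''
    (Set.univ.pi fun _ => minorsGE K m (r + 1))) ((Set.finite_Iic s).biUnion fun l _ =>
      (Set.Finite.pi fun _ => hfin).image _) ?_
  rintro _ ⟨l, f, hf, hs, rfl⟩
  refine Set.mem_biUnion (x := l) ?_ ⟨f, fun i _ => hf i, rfl⟩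
  have : ∑ _i : Fin l, (1 : ℤ) ≤ s := by
    rw [← hs]
    refine Finset.sum_le_sum fun i _ => ?_
    obtain ⟨t, ht, a, b, h⟩ := hf i
    rw [h, totalDegree_symmMinor]
    omega
  simpa using this

/-- Sorting a chain by smaller ends also sorts the larger ends strictly; these are the rows and
columns. -/
theorem exists_symmMinor_of_chain (F : Finset (Sym2 (Fin m)))
    (hF : ∀ e ∈ F, ∀ f ∈ F, e = f ∨ DiagLT e f ∨ DiagLT f e) :
    ∃ a b : Fin F.card ↪o Fin m,
      ∑ i, Finsupp.single s(a i, b i) 1 = ∑ e ∈ F, Finsupp.single e 1 := by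
  have hinj : Set.InjOn Sym2.inf (F : Set (Sym2 (Fin m))) := fun e he f hf h => by
    rcases hF e he f hf with h' | h' | h'
    · exact h'
    · exact absurd h h'.1.ne
    · exact absurd h h'.1.ne'
  have hcard : (F.image Sym2.inf).card = F.card := Finset.card_image_of_injOn hinj
  let a := (F.image Sym2.inf).orderEmbOfFin hcard
  have ha : ∀ i, ∃ e ∈ F, e.inf = a i := fun i =>
    Finset.mem_image.1 (Finset.orderEmbOfFin_mem _ hcard i)
  choose e heF hea using ha
  have hmono : StrictMono fun i => (e i).sup := by
    intro i j hij
    have hlt : (e i).inf < (e j).inf := by rw [hea, hea]; exact a.strictMono hij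
    rcases hF _ (heF i) _ (heF j) with h | h | h
    · exact absurd (congr_arg Sym2.inf h) hlt.ne
    · exact h.2
    · exact absurd h.1 hlt.asymm
  refine ⟨a, OrderEmbedding.ofStrictMono _ hmono, ?_⟩
  have hei : ∀ i, s(a i, (e i).sup) = e i := fun i => by rw [← hea, mk_inf_sup]
  simp only [OrderEmbedding.coe_ofStrictMono, hei]
  have hinj' : Function.Injective e := fun i j h => a.injective (by rw [← hea, ← hea, h])
  exact Finset.sum_nbij e (fun i _ => heF i) hinj'.injOn
    (Finset.surjOn_of_injOn_of_card_le e (fun i _ => heF i) hinj'.injOn (by simp)) fun _ _ => rfl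

/-- If every union of `r` antichains misses at least `s` of the factors of `x^M`, then `x^M` is
divisible by the leading monomial of one of the products of minors. -/
theorem exists_minorProducts_degree_le {ord : MonomialOrder (Sym2 (Fin m))}
    (hord : IsDiagonal K ord) (M : Sym2 (Fin m) →₀ ℕ) (r s : ℕ)
    (h : ∀ τ : Sym2 (Fin m) → Option (Fin r),
      (∀ e ∈ M.support, ∀ e' ∈ M.support, ∀ k, DiagLT e e' → τ e = some k → τ e' ≠ some k) →
        s ≤ (M.filter fun e => τ e = none).degree) :
    ∃ g ∈ minorProducts K m r s, ord.degree g ≤ M := by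
  classical
  -- The factors of `x^M` with multiplicity; copies of one variable are incomparable.
  let P := (e : Sym2 (Fin m)) × Fin (M e)
  let lt : P → P → Prop := fun p q => DiagLT p.1 q.1
  have : IsStrictOrder P lt :=
    { irrefl := fun p => irrefl (r := DiagLT) p.1
      trans := fun p q t => _root_.trans (r := DiagLT) (a := p.1) (b := q.1) (c := t.1) }
  obtain ⟨τ', n, D, c, U, hanti, hcD, hchain, hcard⟩ := exists_antichains_chains lt r
  -- A variable takes the colour of any coloured copy, so it is missed only if all its copies are.
  have hτ : ∀ e, ∃ o : Option (Fin r), (∀ k, o = some k → ∃ i, τ' ⟨e, i⟩ = some k) ∧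
      (o = none → ∀ i, τ' ⟨e, i⟩ = none) := by
    intro e
    by_cases hn : ∀ i, τ' ⟨e, i⟩ = none
    · exact ⟨none, by simp, fun _ => hn⟩
    · push Not at hn
      obtain ⟨i, hi⟩ := hn
      exact ⟨τ' ⟨e, i⟩, fun k hk => ⟨i, hk⟩, fun h => absurd h hi⟩
  choose τ hτs hτn using hτ
  have hs := h τ fun e _ e' _ k hlt he he' => by
    obtain ⟨i, hi⟩ := hτs e k he
    obtain ⟨j, hj⟩ := hτs e' k he'
    exact hanti ⟨e, i⟩ ⟨e', j⟩ k hlt hi hj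
  have hs' : s ≤ (Finset.univ.filter fun p => τ' p = none).card := by
    refine hs.trans ?_
    rw [Finsupp.degree_eq_sum, Finset.card_filter, Fintype.sum_sigma]
    refine Finset.sum_le_sum fun e _ => ?_
    rw [Finsupp.filter_apply]
    split_ifs with he
    · simp [hτn e he]
    · exact Nat.zero_le _
  let F : Fin n → Finset P := fun k => U.filter fun p => c p = k
  let x : Fin n →₀ ℕ := Finsupp.equivFunOnFinite.symm
    fun k => if k ∈ D then (F k).card - r else 0
  have hx : s ≤ x.degree := by
    have h1 : U.card = ∑ k ∈ D, (F k).card := Finset.card_eq_sum_card_fiberwise hcD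
    have h2 : ∑ k ∈ D, (F k).card ≤ ∑ k ∈ D, (((F k).card - r) + r) :=
      Finset.sum_le_sum fun k _ => by omega
    rw [Finset.sum_add_distrib, Finset.sum_const, smul_eq_mul] at h2
    have h3 : x.degree = ∑ k ∈ D, ((F k).card - r) := by
      rw [Finsupp.degree_eq_sum]
      simp [x, Finset.sum_ite_mem]
    have h4 : r * D.card = D.card * r := mul_comm _ _
    omega
  -- The chains may give more than `s`; they are shortened to make the sum exactly `s`.
  obtain ⟨y, hyx, hy⟩ := x.exists_le_degree_eq s hx
  have hpick : ∀ k, ∃ g ∈ minorProducts K m r (y k), ∃ F' ⊆ F k,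
      ord.degree g = ∑ p ∈ F', Finsupp.single p.1 1 := by
    intro k
    rcases Nat.eq_zero_or_pos (y k) with hk | hk
    · exact ⟨1, hk ▸ one_mem_minorProducts r, ∅, by simp, by simp⟩
    · have hk' : r + y k ≤ (F k).card := by
        have h1 : y k ≤ if k ∈ D then (F k).card - r else 0 := hyx k
        split_ifs at h1 <;> omega
      obtain ⟨F', hF', hF'c⟩ := Finset.exists_subset_card_eq hk'
      have hcomp : ∀ p ∈ F', ∀ q ∈ F', p = q ∨ lt p q ∨ lt q p := fun p hp q hq => by
        have hp' := Finset.mem_filter.1 (hF' hp)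
        have hq' := Finset.mem_filter.1 (hF' hq)
        exact hchain p hp'.1 q hq'.1 (hp'.2.trans hq'.2.symm)
      have hinj : Set.InjOn Sigma.fst (F' : Set P) := fun p hp q hq hpq => by
        rcases hcomp p hp q hq with h' | h' | h'
        · exact h'
        · exact absurd hpq fun e => irrefl (r := DiagLT) p.1 (by simpa only [lt, ← e] using h')
        · exact absurd hpq fun e => irrefl (r := DiagLT) p.1 (by simpa only [lt, ← e] using h')
      obtain ⟨a, b, hab⟩ := exists_symmMinor_of_chain (F'.image Sigma.fst) (by
        intro e he f hf
        obtain ⟨p, hp, rfl⟩ := Finset.mem_image.1 he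
        obtain ⟨q, hq, rfl⟩ := Finset.mem_image.1 hf
        exact (hcomp p hp q hq).imp_left (congr_arg _))
      have hcF : (F'.image Sigma.fst).card = r + y k := by
        rw [Finset.card_image_of_injOn hinj, hF'c]
      rw [Finset.sum_image hinj] at hab
      revert a b
      rw [hcF]
      intro a b hab
      exact ⟨_, symmMinor_mem_minorProducts hk a b, F', hF', by rw [hord, hab]⟩
  choose g hg F' hF' hdeg using hpick
  refine ⟨∏ k, g k, ?_, ?_⟩
  · rw [← hy, Finsupp.degree_eq_sum]
    exact prod_mem_minorProducts _ _ _ hg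
  · rw [ord.degree_prod fun k _ => minorProducts_ne_zero (hg k)]
    calc ∑ k, ord.degree (g k) ≤ ∑ k, ∑ p ∈ F k, Finsupp.single p.1 1 :=
          Finset.sum_le_sum fun k _ => by
            rw [hdeg]
            exact Finset.sum_le_sum_of_subset (hF' k)
      _ = ∑ p ∈ U, Finsupp.single p.1 1 := Finset.sum_fiberwise _ _ _
      _ ≤ ∑ p : P, Finsupp.single p.1 1 := Finset.sum_le_sum_of_subset (Finset.subset_univ _)
      _ = M := by
          rw [Fintype.sum_sigma]
          simp [Finsupp.univ_sum_single]

end MinorProducts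

end

end SymmetricMinors

namespace SymmetricMinors

open MvPolynomial

noncomputable section

/-! ### Gröbner bases from divisibility of leading monomials. -/

section GroebnerBases

variable {K : Type*} [Field K] {σ : Type*} {ord : MonomialOrder σ}
  {G : Set (MvPolynomial σ K)} {I : Ideal (MvPolynomial σ K)}

/-- The remainder of division by `G` lies in `I`, and its leading monomial would be reducible unless
it is zero. -/
theorem le_span_of_degree_le (hG : G ⊆ I) (hG0 : ∀ g ∈ G, g ≠ 0)
    (h : ∀ f ∈ I, f ≠ 0 → ∃ g ∈ G, ord.degree g ≤ ord.degree f) : I ≤ Ideal.span G := by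
  intro f hf
  obtain ⟨c, q, hfq, -, hq⟩ := ord.div_set (B := G)
    (fun g hg => isUnit_iff_ne_zero.2 (ord.leadingCoeff_ne_zero_iff.2 (hG0 g hg))) f
  have hc : Finsupp.linearCombination (MvPolynomial σ K)
      (fun b : G => (b : MvPolynomial σ K)) c ∈ Ideal.span G := by
    rw [Finsupp.linearCombination_apply]
    exact Ideal.sum_mem _ fun g _ => Ideal.mul_mem_left _ _ (Ideal.subset_span g.2)
  have hqI : q ∈ I := by
    rw [← I.add_mem_iff_right (Ideal.span_le.2 hG hc), ← hfq]
    exact hf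
  by_cases hq0 : q = 0
  · rw [hfq, hq0, add_zero]
    exact hc
  · obtain ⟨g, hg, hle⟩ := h q hqI hq0
    exact absurd hle (hq _ (ord.degree_mem_support hq0) g hg)

theorem isGroebnerBasis_of_degree_le (hfin : G.Finite) (hG : G ⊆ I) (hG0 : ∀ g ∈ G, g ≠ 0)
    (h : ∀ f ∈ I, f ≠ 0 → ∃ g ∈ G, ord.degree g ≤ ord.degree f) : IsGroebnerBasis ord G I := by
  refine ⟨hfin, hG, le_antisymm (Ideal.span_mono (Set.image_mono hG)) (Ideal.span_le.2 ?_)⟩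
  rintro _ ⟨f, hf, rfl⟩
  by_cases hf0 : f = 0
  · rw [hf0, ord.leadingTerm_zero]
    exact Ideal.zero_mem _
  · obtain ⟨g, hg, hle⟩ := h f hf hf0
    have hlc := ord.leadingCoeff_ne_zero_iff.2 (hG0 g hg)
    have : ord.leadingTerm f = monomial (ord.degree f - ord.degree g)
        (ord.leadingCoeff f / ord.leadingCoeff g) * ord.leadingTerm g := by
      rw [MonomialOrder.leadingTerm, MonomialOrder.leadingTerm, monomial_mul,
        tsub_add_cancel_of_le hle, div_mul_cancel₀ _ hlc]
    rw [this]
    exact Ideal.mul_mem_left _ _ (Ideal.subset_span ⟨g, hg, rfl⟩)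

end GroebnerBases

/-! ### Rank ideals, Gröbner bases and differential perfection. -/

section Main

variable {K : Type*} [Field K] {m : ℕ}

variable (K m) in
/-- The ideal of the closure of the sums of `r` symmetric matrices `v vᵀ`. -/
def rankIdeal (r : ℕ) : Ideal (MvPolynomial (Sym2 (Fin m)) K) :=
  RingHom.ker (aeval (R := K) (gram fun (k : Fin r) i => (X (Sum.inl (k, i)) :
    MvPolynomial (DeformVar m r) K)))

instance (r : ℕ) : (rankIdeal K m r).IsPrime := RingHom.ker_isPrime _

theorem X_dvd_deform_iff {r : ℕ} {f : MvPolynomial (Sym2 (Fin m)) K} :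
    Polynomial.X ∣ deform K m r f ↔ f ∈ rankIdeal K m r := by
  rw [Polynomial.X_dvd_iff, coeff_zero_deform]
  rfl

/-- The multiplier `u ∉ P` of a symbolic power has image prime to `t`, and `t` is a prime element.
-/
theorem X_pow_dvd_deform {r s : ℕ} {f : MvPolynomial (Sym2 (Fin m)) K}
    (hf : f ∈ symbolicPower (rankIdeal K m r) s) : Polynomial.X ^ s ∣ deform K m r f := by
  obtain ⟨u, hu, huf⟩ := mem_symbolicPower.1 hf
  have hle : rankIdeal K m r ≤
      (Ideal.span {(Polynomial.X : Polynomial (MvPolynomial (DeformVar m r) K))}).comap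
        (deform K m r) := fun p hp => by
    rw [Ideal.mem_comap, Ideal.mem_span_singleton]
    exact X_dvd_deform_iff.2 hp
  have h := Ideal.le_comap_pow _ s (Ideal.pow_right_mono hle s huf)
  rw [Ideal.mem_comap, Ideal.span_singleton_pow, Ideal.mem_span_singleton, map_mul] at h
  exact Polynomial.prime_X.pow_dvd_of_dvd_mul_left s (fun h' => hu (X_dvd_deform_iff.1 h')) h

theorem exists_degree_le_of_mem_symbolicPower {ord : MonomialOrder (Sym2 (Fin m))}
    (hord : IsDiagonal K ord) {r s : ℕ} {f : MvPolynomial (Sym2 (Fin m)) K}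
    (hf : f ∈ symbolicPower (rankIdeal K m r) s) (hf0 : f ≠ 0) :
    ∃ g ∈ minorProducts K m r s, ord.degree g ≤ ord.degree f :=
  exists_minorProducts_degree_le hord _ r s fun τ hτ =>
    le_degree_filter_of_dvd_deform hord hf0 (X_pow_dvd_deform hf) τ hτ

theorem exists_symmMinor_dvd_of_mem_minorProducts_one {r : ℕ}
    {g : MvPolynomial (Sym2 (Fin m)) K} (hg : g ∈ minorProducts K m r 1) :
    ∃ a b : Fin (r + 1) ↪o Fin m, symmMinor K a b ∣ g := by
  obtain ⟨l, f, hf, hs, rfl⟩ := hg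
  have hpos : ∀ i, 0 ≤ ((f i).totalDegree : ℤ) - r := fun i => by
    obtain ⟨t, ht, a, b, h⟩ := hf i
    rw [h, totalDegree_symmMinor]
    omega
  cases l with
  | zero => simp at hs
  | succ l =>
    have h0 := Finset.single_le_sum (fun i _ => hpos i) (Finset.mem_univ (0 : Fin (l + 1)))
    rw [hs] at h0
    obtain ⟨t, ht, a, b, h⟩ := hf 0
    rw [h, totalDegree_symmMinor] at h0
    obtain rfl : t = r + 1 := by push_cast at h0; omega
    exact ⟨a, b, h ▸ Finset.dvd_prod_of_mem f (Finset.mem_univ 0)⟩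

theorem minorProducts_one_subset_secant (r : ℕ) :
    minorProducts K m (r + 1) 1 ⊆ secant (symmIdeal K m) (r + 1) := fun _ hg => by
  obtain ⟨a, b, hab⟩ := exists_symmMinor_dvd_of_mem_minorProducts_one hg
  exact Ideal.mem_of_dvd _ hab (det_genericSymm_mem_secant r a b)

/-- The minors lie in the secant ideal, which lies in the rank ideal; the leading-monomial bound for
`s = 1` closes the circle. -/
theorem secant_symmIdeal (r : ℕ) : secant (symmIdeal K m) (r + 1) = rankIdeal K m (r + 1) := by
  have hle : secant (symmIdeal K m) (r + 1) ≤ rankIdeal K m (r + 1) := fun f hf =>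
    aeval_gram_eq_zero r _ hf
  refine le_antisymm hle (le_trans ?_ (Ideal.span_le.2 (minorProducts_one_subset_secant r)))
  exact le_span_of_degree_le (ord := upperLex m)
    (fun g hg => hle (minorProducts_one_subset_secant r hg))
    (fun g hg => minorProducts_ne_zero hg) fun f hf hf0 =>
      exists_degree_le_of_mem_symbolicPower (isDiagonal_upperLex K m)
        (mem_symbolicPower_one.2 hf) hf0

/-- The `r` diagonal variables form `r` one-element antichains that miss no factor of the leading
monomial. -/
theorem symmMinor_notMem_rankIdeal {r : ℕ} (a b : Fin r ↪o Fin m) :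
    symmMinor K a b ∉ rankIdeal K m r := by
  classical
  intro hmem
  have hd := isDiagonal_upperLex K m
  let τ : Sym2 (Fin m) → Option (Fin r) := fun e =>
    if h : ∃ i, s(a i, b i) = e then some h.choose else none
  have hτ : ∀ e k, τ e = some k → s(a k, b k) = e := fun e k h => by
    simp only [τ] at h
    split_ifs at h with h'
    rw [← Option.some_injective _ h]
    exact h'.choose_spec
  have hle := le_degree_filter_of_dvd_deform hd (symmMinor_ne_zero (K := K) a b)
    (s := 1) (X_pow_dvd_deform (mem_symbolicPower_one.2 hmem)) τ fun e _ e' _ k hlt he he' =>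
      irrefl (r := DiagLT) e (by
        have : e = e' := (hτ e k he).symm.trans (hτ e' k he')
        rw [← this] at hlt
        exact hlt)
  have hz : (((upperLex m).degree (symmMinor K a b)).filter fun e => τ e = none) = 0 := by
    ext e
    rw [Finsupp.filter_apply, hd, Finsupp.finsetSum_apply, Finsupp.zero_apply]
    split_ifs with h
    · refine Finset.sum_eq_zero fun i _ => Finsupp.single_eq_of_ne fun h' => ?_
      have : ∃ i, s(a i, b i) = e := ⟨i, h'.symm⟩
      simp [τ, this] at h
    · rfl
  rw [hz, map_zero] at hle
  omega

theorem symmMinor_mem_symbolicPower_rankIdeal {r s : ℕ} (a b : Fin (r + 1 + s) ↪o Fin m) :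
    symmMinor K a b ∈ symbolicPower (rankIdeal K m (r + 1)) s :=
  symmMinor_mem_symbolicPower
    (fun a b => secant_symmIdeal (K := K) r ▸ det_genericSymm_mem_secant r a b)
    symmMinor_notMem_rankIdeal a b

theorem minorProducts_subset_symbolicPower (r s : ℕ) :
    minorProducts K m (r + 1) s ⊆ symbolicPower (rankIdeal K m (r + 1)) s := by
  rintro _ ⟨l, f, hf, hs, rfl⟩
  induction l generalizing s with
  | zero =>
    obtain rfl : s = 0 := by simpa using hs.symm
    rw [SetLike.mem_coe, mem_symbolicPower]
    exact ⟨1, (Ideal.ne_top_iff_one _).1 (inferInstance : (rankIdeal K m (r + 1)).IsPrime).ne_top,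
      by simp⟩
  | succ l ih =>
    obtain ⟨t, ht, a, b, h⟩ := hf 0
    obtain ⟨y, rfl⟩ : ∃ y, t = r + 1 + y := ⟨t - (r + 1), by omega⟩
    rw [Fin.sum_univ_succ, h, totalDegree_symmMinor] at hs
    have hpos : 0 ≤ ∑ i : Fin l, (((f i.succ).totalDegree : ℤ) - (r + 1 : ℕ)) :=
      Finset.sum_nonneg fun i _ => by
        obtain ⟨t, ht, a, b, h⟩ := hf i.succ
        rw [h, totalDegree_symmMinor]
        omega
    obtain ⟨s', rfl⟩ : ∃ s', s = y + s' := ⟨s - y, by push_cast at *; omega⟩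
    rw [Fin.prod_univ_succ, h]
    exact mul_mem_symbolicPower (symmMinor_mem_symbolicPower_rankIdeal a b)
      (ih s' _ (fun i => hf i.succ) (by push_cast at *; omega))

theorem isGroebnerBasis_minorProducts {ord : MonomialOrder (Sym2 (Fin m))}
    (hord : IsDiagonal K ord) (r s : ℕ) :
    IsGroebnerBasis ord (minorProducts K m (r + 1) s)
      (symbolicPower (secant (symmIdeal K m) (r + 1)) s) := by
  rw [secant_symmIdeal]
  exact isGroebnerBasis_of_degree_le (finite_minorProducts _ _)
    (minorProducts_subset_symbolicPower r s) (fun g hg => minorProducts_ne_zero hg)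
    fun f hf hf0 => exists_degree_le_of_mem_symbolicPower hord hf hf0

theorem symbolicPower_rankIdeal_eq_span (r s : ℕ) :
    symbolicPower (rankIdeal K m (r + 1)) s = Ideal.span (minorProducts K m (r + 1) s) :=
  le_antisymm
    (le_span_of_degree_le (ord := upperLex m) (minorProducts_subset_symbolicPower r s)
      (fun _ hg => minorProducts_ne_zero hg) fun _ hf hf0 =>
        exists_degree_le_of_mem_symbolicPower (isDiagonal_upperLex K m) hf hf0)
    (Ideal.span_le.2 (minorProducts_subset_symbolicPower r s))

theorem isDifferentiallyPerfect_symmIdeal : IsDifferentiallyPerfect (symmIdeal K m) := by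
  intro r hr s hs
  obtain ⟨r, rfl⟩ : ∃ r', r = r' + 1 := ⟨r - 1, by omega⟩
  obtain ⟨s, rfl⟩ : ∃ s', s = s' + 1 := ⟨s - 1, by omega⟩
  rw [show r + 1 + (s + 1) - 1 = r + s + 1 by omega, Nat.add_sub_cancel, secant_symmIdeal,
    secant_symmIdeal]
  refine le_antisymm ?_ (sup_le ?_ ?_)
  · rw [symbolicPower_rankIdeal_eq_span, Ideal.span_le]
    rintro _ ⟨l, f, hf, hsum, rfl⟩
    cases l with
    | zero => simp at hsum; omega
    | succ l =>
      obtain ⟨t, ht, a, b, h⟩ := hf 0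
      obtain ⟨y, rfl⟩ : ∃ y, t = r + 1 + y := ⟨t - (r + 1), by omega⟩
      rw [Fin.sum_univ_succ, h, totalDegree_symmMinor] at hsum
      rw [Fin.prod_univ_succ, h]
      -- A single factor is a minor of size `r + s + 2`, in the secant ideal. Otherwise the first
      -- factor has excess between `1` and `s`, and the product splits there.
      cases l with
      | zero =>
        simp only [Finset.univ_eq_empty, Finset.sum_empty, Finset.prod_empty, mul_one] at hsum ⊢
        obtain rfl : y = s + 1 := by push_cast at hsum; omega
        refine Ideal.mem_sup_left ?_
        rw [← secant_symmIdeal]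
        have := det_genericSymm_mem_secant (K := K) (m := m) (r + s)
          (a ∘ Fin.cast (by omega)) (b ∘ Fin.cast (by omega))
        convert this using 1
        rw [symmMinor, ← Matrix.det_submatrix_equiv_self (finCongr (by omega :
          r + s + 2 = r + 1 + (s + 1)))]
        rfl
      | succ l =>
        have hpos : ∑ _i : Fin (l + 1), (1 : ℤ) ≤
            ∑ i : Fin (l + 1), (((f i.succ).totalDegree : ℤ) - (r + 1 : ℕ)) :=
          Finset.sum_le_sum fun i _ => by
            obtain ⟨t, ht, a, b, h⟩ := hf i.succ
            rw [h, totalDegree_symmMinor]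
            omega
        simp only [Finset.sum_const, Finset.card_univ, Fintype.card_fin, nsmul_eq_mul,
          mul_one] at hpos
        refine Ideal.mem_sup_right ?_
        have hy : y ∈ Finset.Icc 1 s := by
          rw [Finset.mem_Icc]
          push_cast at *
          omega
        rw [Ideal.sum_eq_sup]
        refine Finset.le_sup (f := fun i => symbolicPower (rankIdeal K m (r + 1)) i *
          symbolicPower (rankIdeal K m (r + 1)) (s + 1 - i)) hy ?_
        refine Ideal.mul_mem_mul (symmMinor_mem_symbolicPower_rankIdeal a b)
          (minorProducts_subset_symbolicPower r _ ⟨_, _, fun i => hf i.succ, ?_, rfl⟩)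
        rw [Finset.mem_Icc] at hy
        rw [Nat.cast_sub (by omega)]
        push_cast at *
        omega
  · intro f hf
    rw [← mem_symbolicPower_one, symbolicPower_rankIdeal_eq_span] at hf
    refine Ideal.span_le.2 (fun g hg => ?_) hf
    obtain ⟨a, b, hab⟩ := exists_symmMinor_dvd_of_mem_minorProducts_one hg
    refine Ideal.mem_of_dvd _ hab ?_
    revert a b
    rw [show r + s + 1 + 1 = r + 1 + (s + 1) by omega]
    intro a b _
    exact symmMinor_mem_symbolicPower_rankIdeal a b
  · refine Finset.sum_induction _ (· ≤ symbolicPower (rankIdeal K m (r + 1)) (s + 1))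
      (fun _ _ => sup_le) bot_le fun i hi => Ideal.mul_le.2 fun p hp q hq => ?_
    have := mul_mem_symbolicPower hp hq
    rw [Finset.mem_Icc] at hi
    rwa [show i + (s + 1 - i) = s + 1 by omega] at this

end Main

end

end SymmetricMinors

theorem mainTheorem8 (K : Type*) [Field K] [IsAlgClosed K] (m : ℕ) :
    SymmetricMinors.IsDifferentiallyPerfect (SymmetricMinors.symmIdeal K m) ∧
    ∀ ord : MonomialOrder (Sym2 (Fin m)), SymmetricMinors.IsDiagonal K ord →
      ∀ r s : ℕ, 1 ≤ r → 1 ≤ s →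
        SymmetricMinors.IsGroebnerBasis ord (SymmetricMinors.minorProducts K m r s)
          (SymmetricMinors.symbolicPower
            (SymmetricMinors.secant (SymmetricMinors.symmIdeal K m) r) s) := by
  refine ⟨SymmetricMinors.isDifferentiallyPerfect_symmIdeal, fun ord hord r s hr _ => ?_⟩
  obtain ⟨r, rfl⟩ : ∃ r', r = r' + 1 := ⟨r - 1, by omega⟩
  exact SymmetricMinors.isGroebnerBasis_minorProducts hord r s
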